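/- Consider the Cauchy problem for the equations of plane one-dimensional relativistic oscillations of a cold plasma, $$P_\theta+V P_\rho+E=0,\qquad E_\theta+V E_\rho-V=0,\qquad V=\frac{P}{\sqrt{1+P^2}},\qquad \rho\in\mathbb R,\ \theta>0,$$ with initial data $P(\rho,0)=P_0(\rho)$, $E(\rho,0)=E_0(\rho)$, where $P_0,E_0\in C^1(\mathbb R)$ have uniformly bounded derivatives on $\mathbb R$. There is an $\varepsilon>0$ such that, whenever $|P_0(\rho)|\le\varepsilon$ and $|E_0(\rho)|\le\varepsilon$ for all $\rho\in\mathbb R$ (a small deviation from the equilibrium $P=E=0$) and the function $2\sqrt{1+P_0^2}+E_0^2$ is not identically constant on $\mathbb R$, the derivatives of the solution become infinite in a finite time. Precisely: there are a finite $T>0$ and a $C^1$ solution $(P,E)$ on $\mathbb R\times[0,T)$ such that every $C^1$ solution with the same data on a strip $\mathbb R\times[0,T')$ satisfies $T'\le T$ and coincides with $(P,E)$ there, and $$\sup_{\rho\in\mathbb R}\bigl(|P_\rho(\rho,\theta)|+|E_\rho(\rho,\theta)|\bigr)\to\infty\quad\text{as }\theta\uparrow T .$$ -/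

import Mathlib

namespace ColdPlasma

open Set Filter Topology
open scoped ENNReal

/-- The dimensionless electron velocity `V = P / √(1 + P²)` belonging to the momentum `P`. -/
noncomputable def velocity (P : ℝ) : ℝ := P / Real.sqrt (1 + P ^ 2)

/-- The energy `2 √(1 + P²) + E²`. -/
noncomputable def energy (P E : ℝ) : ℝ := 2 * Real.sqrt (1 + P ^ 2) + E ^ 2

/-- Admissible initial data: a `C¹` function on the line with uniformly bounded derivative. -/
def IsAdmissibleDatum (f : ℝ → ℝ) : Prop :=
  ContDiff ℝ 1 f ∧ ∃ L : ℝ, ∀ ρ : ℝ, |deriv f ρ| ≤ L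

/-- The functions `P` and `E` of `(ρ, θ)` (position, time) form a `C¹` solution on `ℝ × [0, T)`
(continuously differentiable up to `θ = 0`) of the relativistic cold plasma equations
`P_θ + V P_ρ + E = 0`, `E_θ + V E_ρ - V = 0`, `V = P / √(1 + P²)`,
with initial data `P(ρ, 0) = P₀(ρ)`, `E(ρ, 0) = E₀(ρ)`. -/
structure IsC1Solution (P₀ E₀ : ℝ → ℝ) (T : ℝ) (P E : ℝ × ℝ → ℝ) : Prop where
  contDiffOn_P : ContDiffOn ℝ 1 P (univ ×ˢ Ico 0 T)
  contDiffOn_E : ContDiffOn ℝ 1 E (univ ×ˢ Ico 0 T)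
  eq_P : ∀ ρ : ℝ, ∀ θ ∈ Ioo 0 T,
    deriv (fun s => P (ρ, s)) θ + velocity (P (ρ, θ)) * deriv (fun r => P (r, θ)) ρ
      + E (ρ, θ) = 0
  eq_E : ∀ ρ : ℝ, ∀ θ ∈ Ioo 0 T,
    deriv (fun s => E (ρ, s)) θ + velocity (P (ρ, θ)) * deriv (fun r => E (r, θ)) ρ
      - velocity (P (ρ, θ)) = 0
  init_P : ∀ ρ : ℝ, P (ρ, 0) = P₀ ρ
  init_E : ∀ ρ : ℝ, E (ρ, 0) = E₀ ρ

/-- `sup_ρ (|P_ρ(ρ, θ)| + |E_ρ(ρ, θ)|)`, with values in `[0, ∞]`. -/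
noncomputable def gradSup (P E : ℝ × ℝ → ℝ) (θ : ℝ) : ℝ≥0∞ :=
  ⨆ ρ : ℝ, ENNReal.ofReal (|deriv (fun r => P (r, θ)) ρ| + |deriv (fun r => E (r, θ)) ρ|)

/-- The solution with initial data `(P₀, E₀)` loses smoothness at the finite time `T`: there is a
`C¹` solution on `ℝ × [0, T)`, every `C¹` solution with the same data lives on a time interval
contained in `[0, T)` and is a restriction of it (it is the unique maximal `C¹` solution), and its
spatial derivatives become infinite as `θ ↑ T`. -/
def DerivativesBlowUpAt (P₀ E₀ : ℝ → ℝ) (T : ℝ) : Prop :=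
  0 < T ∧ ∃ P E : ℝ × ℝ → ℝ,
    IsC1Solution P₀ E₀ T P E ∧
    (∀ (T' : ℝ) (Q F : ℝ × ℝ → ℝ), IsC1Solution P₀ E₀ T' Q F →
      T' ≤ T ∧ EqOn Q P (univ ×ˢ Ico 0 T') ∧ EqOn F E (univ ×ˢ Ico 0 T')) ∧
    Tendsto (gradSup P E) (𝓝[<] T) (𝓝 ⊤)

end ColdPlasma

/-! Along a characteristic, `X' = V(P)`, `P' = -E`, `E' = V(P)`. Hence `X - E` is constant there,
and the position is explicit: `X = x - E₀ x + E`. The pair `(P, E)` solves an autonomous oscillator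
with conserved `energy`, defined for all times. A `C¹` solution can therefore fail only because
characteristics meet, that is, because the Jacobian `J = ∂X/∂x = 1 - E₀' + b` reaches zero, where
`(a, b) = ∂(P, E)/∂x` solves the linearized system.

The oscillator is not isochronous, so neighbouring orbits of different energy shear apart. To see
this without computing periods, note that `h = V a + E b`, half the derivative of the energy in `x`,
is conserved. With `D = P V + E²`, write `(a, b) = α (-E, V) + (h / D) (P, E)`. Then `α' = -h V³ P /
D²`, so `h α` never increases. Since `(P E)' = P V - E²` while `P E` stays bounded, `P V` cannot
remain small, and `h α → -∞` (`exists_forall_phase_le`). The velocity keeps returning to sizeable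
values of either sign (`exists_le_velocity`), so `b` is unbounded below wherever `h ≠ 0`
(`exists_linearized_le`). Nonconstant energy of the data provides such an `x`, and there `J ≤ 0` at
some finite time.

The lifespan `T` is the infimum of the times at which `J ≤ 0` somewhere. Before `T` the
characteristics form a `C¹` change of variables, and transport along them gives the solution. Any
`C¹` solution is so transported, and it forces `J > 0`, which gives uniqueness and maximality.
Finally `P_ρ J = a` and `E_ρ J = b`, where `(a, b)` stays away from zero when `J` is small; hence
the gradient blows up. -/

namespace ColdPlasma

open Set Filter Topology
open scoped ENNReal NNReal Manifold

/-! ### Global flows of vector fields of linear growth -/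

section ODE

variable {E : Type*} [NormedAddCommGroup E] [NormedSpace ℝ E]

/-- Two-sided Grönwall inequality on a symmetric time interval. -/
theorem norm_le_gronwallBound_abs {f f' : ℝ → E} {K ε T : ℝ}
    (hf : ∀ t, |t| ≤ T → HasDerivAt f (f' t) t)
    (bound : ∀ t, |t| ≤ T → ‖f' t‖ ≤ K * ‖f t‖ + ε) {t : ℝ} (ht : |t| ≤ T) :
    ‖f t‖ ≤ gronwallBound ‖f 0‖ K ε |t| := by
  have key : ∀ {g g' : ℝ → E}, (∀ t, |t| ≤ T → HasDerivAt g (g' t) t) →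
      (∀ t, |t| ≤ T → ‖g' t‖ ≤ K * ‖g t‖ + ε) → ∀ t, 0 ≤ t → t ≤ T →
      ‖g t‖ ≤ gronwallBound ‖g 0‖ K ε t := by
    intro g g' hg hb t h0 hT
    have hmem : ∀ s ∈ Icc 0 t, |s| ≤ T := fun s hs => by
      rw [abs_of_nonneg hs.1]; exact hs.2.trans hT
    have := norm_le_gronwallBound_of_norm_deriv_right_le (f := g) (f' := g') (δ := ‖g 0‖)
      (K := K) (ε := ε) (a := 0) (b := t)
      (fun s hs => (hg s (hmem s hs)).continuousAt.continuousWithinAt)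
      (fun s hs => (hg s (hmem s (Ico_subset_Icc_self hs))).hasDerivWithinAt) le_rfl
      (fun s hs => hb s (hmem s (Ico_subset_Icc_self hs))) t ⟨h0, le_rfl⟩
    simpa using this
  rcases le_total 0 t with h0 | h0
  · rw [abs_of_nonneg h0] at ht ⊢
    exact key hf bound t h0 ht
  · rw [abs_of_nonpos h0] at ht ⊢
    have := key (g := fun s => f (-s)) (g' := fun s => -f' (-s))
      (fun s hs => by
        have h := (hf (-s) (by simpa using hs)).scomp s (hasDerivAt_neg s)
        simpa [Function.comp_def] using h)
      (fun s hs => by simpa using bound (-s) (by simpa using hs)) (-t) (by linarith) ht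
    simpa using this

/-- If `‖f'‖ ≤ ‖f‖`, then `‖f‖` grows at most exponentially, forwards and backwards. -/
theorem norm_le_norm_mul_exp {f f' : ℝ → E} (hf : ∀ t, HasDerivAt f (f' t) t)
    (bound : ∀ t, ‖f' t‖ ≤ ‖f t‖) (s t : ℝ) : ‖f t‖ ≤ ‖f s‖ * Real.exp |t - s| := by
  have h := norm_le_gronwallBound_abs (f := fun r => f (s + r)) (f' := fun r => f' (s + r))
    (K := 1) (ε := 0) (T := |t - s|) (t := t - s)
    (fun r _ => by simpa using (hf (s + r)).comp_const_add s r)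
    (fun r _ => by simpa using bound (s + r)) le_rfl
  simpa [gronwallBound_ε0] using h

variable [FiniteDimensional ℝ E] {F : E → E}

/-- A `C¹` vector field of at most linear growth on a finite-dimensional space is complete. -/
theorem exists_forall_hasDerivAt_of_norm_le (hF : ContDiff ℝ 1 F) (hb : ∀ x, ‖F x‖ ≤ ‖x‖)
    (x : E) : ∃ γ : ℝ → E, γ 0 = x ∧ ∀ t, HasDerivAt γ (F (γ t)) t := by
  have : CompleteSpace E := FiniteDimensional.complete ℝ E
  have : ProperSpace E := FiniteDimensional.proper ℝ E
  have hloc : ∀ x : E, ∃ γ : ℝ → E, γ 0 = x ∧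
      ∀ t ∈ Ioo (-(1 / 2 : ℝ)) (1 / 2), HasDerivAt γ (F (γ t)) t := by
    intro x
    obtain ⟨K, hK⟩ := hF.contDiffOn.exists_lipschitzOnWith (s := Metric.closedBall x (‖x‖₊ + 1))
      one_ne_zero (convex_closedBall _ _) (isCompact_closedBall _ _)
    -- On the ball of radius `‖x‖ + 1` about `x` the field is at most `2‖x‖ + 1`, so half a unit of
    -- time never leaves the ball. This time does not depend on `x`, which is what allows local
    -- curves to be glued into a global one.
    have hPL : IsPicardLindelof (fun _ => F) (tmin := -(1 / 2)) (tmax := 1 / 2)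
        ⟨0, by norm_num⟩ x (‖x‖₊ + 1) 0 (2 * ‖x‖₊ + 1) K := by
      refine IsPicardLindelof.of_time_independent (fun y hy => ?_) (by simpa using hK) ?_
      · refine (hb y).trans ?_
        have h1 : ‖y - x‖ ≤ ‖x‖ + 1 := by simpa [dist_eq_norm] using hy
        have h2 := norm_le_norm_sub_add y x
        push_cast
        linarith
      · push_cast
        norm_num
        linarith [norm_nonneg x]
    obtain ⟨γ, h0, hγ⟩ := hPL.exists_eq_forall_mem_Icc_hasDerivWithinAt₀
    exact ⟨γ, h0, fun t ht => (hγ t (Ioo_subset_Icc_self ht)).hasDerivAt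
      (Icc_mem_nhds ht.1 ht.2)⟩
  have hv : ContMDiff 𝓘(ℝ, E) 𝓘(ℝ, E).tangent 1
      (fun y => (⟨y, F y⟩ : TangentBundle 𝓘(ℝ, E) E)) :=
    contMDiff_vectorSpace_iff_contDiff.2 hF
  obtain ⟨γ, h0, hγ⟩ := exists_isMIntegralCurve_of_isMIntegralCurveOn hv
    (ε := 1 / 2) (by norm_num) (fun y => by
      obtain ⟨γ, h0, hγ⟩ := hloc y
      exact ⟨γ, h0, fun t ht => (hγ t ht).hasDerivWithinAt.hasFDerivWithinAt.hasMFDerivWithinAt⟩) x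
  exact ⟨γ, h0, fun t => by
    have h : HasFDerivAt γ ((1 : ℝ →L[ℝ] ℝ).smulRight (F (γ t))) t :=
      hasMFDerivAt_iff_hasFDerivAt.1 (hγ t)
    simpa using h.hasDerivAt⟩

/-- Integral curves of a `C¹` vector field of at most linear growth depend on their initial points
in a Lipschitz way, locally uniformly. -/
theorem exists_norm_sub_le_mul_norm_sub (hF : ContDiff ℝ 1 F) (hb : ∀ x, ‖F x‖ ≤ ‖x‖)
    (R T : ℝ) : ∃ C : ℝ, 0 ≤ C ∧ ∀ γ₁ γ₂ : ℝ → E, (∀ t, HasDerivAt γ₁ (F (γ₁ t)) t) →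
      (∀ t, HasDerivAt γ₂ (F (γ₂ t)) t) → ‖γ₁ 0‖ ≤ R → ‖γ₂ 0‖ ≤ R → ∀ t, |t| ≤ T →
      ‖γ₁ t - γ₂ t‖ ≤ C * ‖γ₁ 0 - γ₂ 0‖ := by
  have : ProperSpace E := FiniteDimensional.proper ℝ E
  -- Curves starting in the ball of radius `R` stay in this larger one up to time `T`, so one
  -- Lipschitz constant serves them all.
  obtain ⟨K, hK⟩ := hF.contDiffOn.exists_lipschitzOnWith
    (s := Metric.closedBall (0 : E) (R * Real.exp T))
    one_ne_zero (convex_closedBall _ _) (isCompact_closedBall _ _)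
  refine ⟨Real.exp (K * T), (Real.exp_pos _).le, fun γ₁ γ₂ h₁ h₂ hR₁ hR₂ t ht => ?_⟩
  have hmem : ∀ γ : ℝ → E, (∀ t, HasDerivAt γ (F (γ t)) t) → ‖γ 0‖ ≤ R → ∀ s, |s| ≤ T →
      γ s ∈ Metric.closedBall (0 : E) (R * Real.exp T) := by
    intro γ hγ hR s hs
    rw [mem_closedBall_zero_iff]
    have h := norm_le_norm_mul_exp hγ (fun t => hb _) 0 s
    rw [sub_zero] at h
    have h0 : 0 ≤ R := (norm_nonneg _).trans hR
    refine h.trans ?_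
    gcongr
  have h := norm_le_gronwallBound_abs (f := fun r => γ₁ r - γ₂ r)
    (f' := fun r => F (γ₁ r) - F (γ₂ r)) (K := K) (ε := 0) (T := T)
    (fun r _ => (h₁ r).sub (h₂ r))
    (fun r hr => by
      simpa using hK.norm_sub_le (hmem γ₁ h₁ hR₁ r hr) (hmem γ₂ h₂ hR₂ r hr)) ht
  rw [gronwallBound_ε0, mul_comm] at h
  refine h.trans ?_
  gcongr

/-- The flow of a `C¹` vector field of at most linear growth is jointly continuous. -/
theorem continuous_of_forall_hasDerivAt (hF : ContDiff ℝ 1 F) (hb : ∀ x, ‖F x‖ ≤ ‖x‖)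
    {Γ : E → ℝ → E} (h0 : ∀ x, Γ x 0 = x) (hΓ : ∀ x t, HasDerivAt (Γ x) (F (Γ x t)) t) :
    Continuous fun q : E × ℝ => Γ q.1 q.2 := by
  rw [continuous_iff_continuousAt]
  rintro ⟨x, t⟩
  obtain ⟨C, hC0, hC⟩ := exists_norm_sub_le_mul_norm_sub hF hb (‖x‖ + 1) (|t| + 1)
  rw [ContinuousAt, tendsto_iff_norm_sub_tendsto_zero]
  have hlim : Tendsto (fun q : E × ℝ => C * ‖q.1 - x‖ + ‖Γ x q.2 - Γ x t‖) (𝓝 (x, t)) (𝓝 0) := by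
    have hc : Continuous (Γ x) := continuous_iff_continuousAt.2 fun s => (hΓ x s).continuousAt
    have : Continuous (fun q : E × ℝ => C * ‖q.1 - x‖ + ‖Γ x q.2 - Γ x t‖) := by fun_prop
    simpa using this.tendsto (x, t)
  refine squeeze_zero' (Eventually.of_forall fun q => norm_nonneg _) ?_ hlim
  filter_upwards [Metric.ball_mem_nhds (x, t) one_pos] with q hq
  rw [Metric.mem_ball, Prod.dist_eq, max_lt_iff, dist_eq_norm, Real.dist_eq] at hq
  have h1 : ‖q.1‖ ≤ ‖x‖ + 1 := by
    linarith [norm_le_norm_sub_add q.1 x, hq.1]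
  have h2 : |q.2| ≤ |t| + 1 := by
    have := abs_add_le (q.2 - t) t
    rw [sub_add_cancel] at this
    have := hq.2
    dsimp only at *
    linarith
  have h := hC (Γ q.1) (Γ x) (hΓ _) (hΓ _) (by rwa [h0]) (by rw [h0]; linarith) q.2 h2
  rw [h0, h0] at h
  calc ‖Γ q.1 q.2 - Γ x t‖ ≤ ‖Γ q.1 q.2 - Γ x q.2‖ + ‖Γ x q.2 - Γ x t‖ := by
        simpa using norm_add_le (Γ q.1 q.2 - Γ x q.2) (Γ x q.2 - Γ x t)
    _ ≤ _ := by gcongr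

end ODE

/-! ### The velocity function -/

/-- The derivative `(1 + P²)^(-3/2)` of the velocity. -/
noncomputable def velocityDeriv (P : ℝ) : ℝ := 1 / Real.sqrt (1 + P ^ 2) ^ 3

theorem one_le_sqrt_one_add_sq (p : ℝ) : 1 ≤ Real.sqrt (1 + p ^ 2) := by
  rw [Real.one_le_sqrt]; nlinarith [sq_nonneg p]

theorem sq_sqrt_one_add_sq (p : ℝ) : Real.sqrt (1 + p ^ 2) ^ 2 = 1 + p ^ 2 :=
  Real.sq_sqrt (by positivity)

theorem hasDerivAt_sqrt_one_add_sq (p : ℝ) :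
    HasDerivAt (fun p => Real.sqrt (1 + p ^ 2)) (velocity p) p := by
  have h : HasDerivAt (fun p : ℝ => 1 + p ^ 2) (2 * p) p := by
    simpa using (hasDerivAt_pow 2 p).const_add 1
  convert h.sqrt (by positivity) using 1
  unfold velocity
  field_simp

theorem hasDerivAt_velocity (p : ℝ) : HasDerivAt velocity (velocityDeriv p) p := by
  have h1 := one_le_sqrt_one_add_sq p
  have h2 := sq_sqrt_one_add_sq p
  refine ((hasDerivAt_id p).div (hasDerivAt_sqrt_one_add_sq p) (by positivity)).congr_deriv ?_
  unfold velocityDeriv velocity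
  simp only [id]
  field_simp
  linarith

theorem contDiff_velocity {n : WithTop ℕ∞} : ContDiff ℝ n velocity := by
  refine contDiff_id.div (ContDiff.sqrt (by fun_prop) fun p => by positivity) fun p => ?_
  exact (zero_lt_one.trans_le (one_le_sqrt_one_add_sq p)).ne'

theorem contDiff_velocityDeriv {n : WithTop ℕ∞} : ContDiff ℝ n velocityDeriv := by
  refine contDiff_const.div
    ((ContDiff.sqrt (by fun_prop) fun p => by positivity).pow 3) fun p => ?_
  exact (pow_pos (zero_lt_one.trans_le (one_le_sqrt_one_add_sq p)) 3).ne'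

theorem abs_velocity_le (p : ℝ) : |velocity p| ≤ |p| := by
  have h1 := one_le_sqrt_one_add_sq p
  rw [velocity, abs_div, abs_of_pos (zero_lt_one.trans_le h1)]
  exact div_le_self (abs_nonneg p) h1

theorem abs_velocity_le_one (p : ℝ) : |velocity p| ≤ 1 := by
  have h1 := one_le_sqrt_one_add_sq p
  rw [velocity, abs_div, abs_of_pos (zero_lt_one.trans_le h1), div_le_one (by positivity)]
  exact Real.abs_le_sqrt (by linarith)

theorem velocityDeriv_pos (p : ℝ) : 0 < velocityDeriv p := by
  have h1 := one_le_sqrt_one_add_sq p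
  unfold velocityDeriv; positivity

theorem velocityDeriv_le_one (p : ℝ) : velocityDeriv p ≤ 1 := by
  have h1 := one_le_sqrt_one_add_sq p
  rw [velocityDeriv, div_le_one (by positivity)]
  exact one_le_pow₀ h1

theorem abs_velocityDeriv_mul_le (p a : ℝ) : |velocityDeriv p * a| ≤ |a| := by
  rw [abs_mul, abs_of_pos (velocityDeriv_pos p)]
  exact mul_le_of_le_one_left (abs_nonneg a) (velocityDeriv_le_one p)

theorem abs_velocity_sub_le (p q : ℝ) : |velocity q - velocity p| ≤ |q - p| := by
  have := convex_univ.norm_image_sub_le_of_norm_hasDerivWithin_le (f := velocity)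
    (f' := velocityDeriv) (C := 1) (x := p) (y := q)
    (fun x _ => (hasDerivAt_velocity x).hasDerivWithinAt)
    (fun x _ => by
      rw [Real.norm_eq_abs, abs_of_pos (velocityDeriv_pos x)]; exact velocityDeriv_le_one x)
    (mem_univ _) (mem_univ _)
  simpa using this

theorem abs_velocityDeriv_sub_le (p q : ℝ) :
    |velocityDeriv q - velocityDeriv p| ≤ 3 * |q - p| := by
  have hd : ∀ x, HasDerivAt velocityDeriv
      (-(3 * Real.sqrt (1 + x ^ 2) ^ 2 * velocity x) / (Real.sqrt (1 + x ^ 2) ^ 3) ^ 2) x := by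
    intro x
    have h1 := one_le_sqrt_one_add_sq x
    have h3 : Real.sqrt (1 + x ^ 2) ^ 3 ≠ 0 := by positivity
    refine ((hasDerivAt_const x (1 : ℝ)).div ((hasDerivAt_sqrt_one_add_sq x).pow 3)
      h3).congr_deriv ?_
    simp
  have := convex_univ.norm_image_sub_le_of_norm_hasDerivWithin_le (f := velocityDeriv)
    (C := 3) (x := p) (y := q)
    (fun x _ => (hd x).hasDerivWithinAt)
    (fun x _ => by
      have h1 := one_le_sqrt_one_add_sq x
      have h0 : 0 < (Real.sqrt (1 + x ^ 2) ^ 3) ^ 2 := by positivity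
      rw [Real.norm_eq_abs, abs_div, abs_neg, abs_mul, abs_of_pos h0, div_le_iff₀ h0,
        abs_of_nonneg (by positivity : (0 : ℝ) ≤ 3 * Real.sqrt (1 + x ^ 2) ^ 2)]
      have h2 := abs_velocity_le_one x
      have h3 : Real.sqrt (1 + x ^ 2) ^ 2 ≤ (Real.sqrt (1 + x ^ 2) ^ 3) ^ 2 := by
        rw [← pow_mul]; exact pow_le_pow_right₀ h1 (by norm_num)
      nlinarith [abs_nonneg (velocity x), sq_nonneg (Real.sqrt (1 + x ^ 2))])
    (mem_univ _) (mem_univ _)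
  simpa using this

/-- Taylor remainder, with 3 the Lipschitz constant of `velocityDeriv`. It controls the error of the
linearization in `hasDerivAt_char`. -/
theorem abs_velocity_sub_sub_le (p q : ℝ) :
    |velocity q - velocity p - velocityDeriv p * (q - p)| ≤ 3 * |q - p| ^ 2 := by
  have := (convex_uIcc p q).norm_image_sub_le_of_norm_hasDerivWithin_le
    (f := fun x => velocity x - velocityDeriv p * x)
    (f' := fun x => velocityDeriv x - velocityDeriv p) (C := 3 * |q - p|) (x := p) (y := q)
    (fun x _ => by
      have h := ((hasDerivAt_velocity x).sub
        ((hasDerivAt_id x).const_mul (velocityDeriv p))).hasDerivWithinAt (s := uIcc p q)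
      rw [mul_one] at h
      exact h)
    (fun x hx => by
      refine (abs_velocityDeriv_sub_le p x).trans ?_
      have := abs_sub_left_of_mem_uIcc hx
      linarith)
    left_mem_uIcc right_mem_uIcc
  calc _ = ‖velocity q - velocityDeriv p * q - (velocity p - velocityDeriv p * p)‖ := by
        rw [Real.norm_eq_abs]; ring_nf
    _ ≤ _ := this
    _ = _ := by rw [Real.norm_eq_abs]; ring

/-! ### The characteristic system and its linearization -/

/-- The system `P' = -E`, `E' = V(P)` satisfied along characteristics, together with its
linearization `a' = -b`, `b' = V'(P) a`. -/
noncomputable def tangentField (x : (ℝ × ℝ) × (ℝ × ℝ)) : (ℝ × ℝ) × (ℝ × ℝ) :=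
  ((-x.1.2, velocity x.1.1), (-x.2.2, velocityDeriv x.1.1 * x.2.1))

theorem contDiff_tangentField : ContDiff ℝ 1 tangentField := by
  have h1 : ContDiff ℝ 1 velocity := contDiff_velocity
  have h2 : ContDiff ℝ 1 velocityDeriv := contDiff_velocityDeriv
  unfold tangentField
  fun_prop

theorem norm_tangentField_le (x : (ℝ × ℝ) × (ℝ × ℝ)) : ‖tangentField x‖ ≤ ‖x‖ := by
  obtain ⟨⟨p, e⟩, ⟨a, b⟩⟩ := x
  have h1 := abs_velocity_le p
  have h2 := abs_velocityDeriv_mul_le p a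
  simp only [tangentField, Prod.norm_def, Real.norm_eq_abs, abs_neg]
  refine max_le (max_le ?_ ?_) (max_le ?_ ?_)
  · exact le_max_of_le_left (le_max_right _ _)
  · exact le_max_of_le_left (le_max_of_le_left h1)
  · exact le_max_of_le_right (le_max_right _ _)
  · exact le_max_of_le_right (le_max_of_le_left h2)

/-- The flow of `tangentField`. -/
noncomputable def tangentFlow (x : (ℝ × ℝ) × (ℝ × ℝ)) : ℝ → (ℝ × ℝ) × (ℝ × ℝ) :=
  (exists_forall_hasDerivAt_of_norm_le contDiff_tangentField norm_tangentField_le x).choose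

theorem tangentFlow_zero (x : (ℝ × ℝ) × (ℝ × ℝ)) : tangentFlow x 0 = x :=
  (exists_forall_hasDerivAt_of_norm_le contDiff_tangentField norm_tangentField_le x).choose_spec.1

theorem hasDerivAt_tangentFlow (x : (ℝ × ℝ) × (ℝ × ℝ)) (t : ℝ) :
    HasDerivAt (tangentFlow x) (tangentField (tangentFlow x t)) t :=
  (exists_forall_hasDerivAt_of_norm_le contDiff_tangentField norm_tangentField_le x).choose_spec.2 t

theorem continuous_tangentFlow :
    Continuous fun q : ((ℝ × ℝ) × (ℝ × ℝ)) × ℝ => tangentFlow q.1 q.2 :=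
  continuous_of_forall_hasDerivAt contDiff_tangentField norm_tangentField_le tangentFlow_zero
    hasDerivAt_tangentFlow

/-- The momentum, the field and their derivatives with respect to the starting point, along the
characteristics of the Cauchy problem with data `P₀`, `E₀`. -/
noncomputable def lagrangian (P₀ E₀ : ℝ → ℝ) (x t : ℝ) : (ℝ × ℝ) × (ℝ × ℝ) :=
  tangentFlow ((P₀ x, E₀ x), (deriv P₀ x, deriv E₀ x)) t

/-- The momentum at time `t` on the characteristic starting at `x`. -/
noncomputable def charP (P₀ E₀ : ℝ → ℝ) (x t : ℝ) : ℝ := (lagrangian P₀ E₀ x t).1.1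

/-- The electric field at time `t` on the characteristic starting at `x`. -/
noncomputable def charE (P₀ E₀ : ℝ → ℝ) (x t : ℝ) : ℝ := (lagrangian P₀ E₀ x t).1.2

/-- The derivative of `charP` with respect to the starting point. -/
noncomputable def charDP (P₀ E₀ : ℝ → ℝ) (x t : ℝ) : ℝ := (lagrangian P₀ E₀ x t).2.1

/-- The derivative of `charE` with respect to the starting point. -/
noncomputable def charDE (P₀ E₀ : ℝ → ℝ) (x t : ℝ) : ℝ := (lagrangian P₀ E₀ x t).2.2

section Lagrangian

variable {P₀ E₀ : ℝ → ℝ}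

theorem charP_zero (x : ℝ) : charP P₀ E₀ x 0 = P₀ x := by
  simp [charP, lagrangian, tangentFlow_zero]

theorem charE_zero (x : ℝ) : charE P₀ E₀ x 0 = E₀ x := by
  simp [charE, lagrangian, tangentFlow_zero]

theorem charDP_zero (x : ℝ) : charDP P₀ E₀ x 0 = deriv P₀ x := by
  simp [charDP, lagrangian, tangentFlow_zero]

theorem charDE_zero (x : ℝ) : charDE P₀ E₀ x 0 = deriv E₀ x := by
  simp [charDE, lagrangian, tangentFlow_zero]

theorem hasDerivAt_charP (x t : ℝ) : HasDerivAt (charP P₀ E₀ x) (-charE P₀ E₀ x t) t :=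
  (hasDerivAt_tangentFlow _ t).fst.fst

theorem hasDerivAt_charE (x t : ℝ) :
    HasDerivAt (charE P₀ E₀ x) (velocity (charP P₀ E₀ x t)) t :=
  (hasDerivAt_tangentFlow _ t).fst.snd

theorem hasDerivAt_charDP (x t : ℝ) : HasDerivAt (charDP P₀ E₀ x) (-charDE P₀ E₀ x t) t :=
  (hasDerivAt_tangentFlow _ t).snd.fst

theorem hasDerivAt_charDE (x t : ℝ) :
    HasDerivAt (charDE P₀ E₀ x) (velocityDeriv (charP P₀ E₀ x t) * charDP P₀ E₀ x t) t :=
  (hasDerivAt_tangentFlow _ t).snd.snd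

theorem continuous_lagrangian (hP : ContDiff ℝ 1 P₀) (hE : ContDiff ℝ 1 E₀) :
    Continuous fun q : ℝ × ℝ => lagrangian P₀ E₀ q.1 q.2 := by
  have h1 := hP.continuous
  have h2 := hE.continuous
  have h3 := hP.continuous_deriv le_rfl
  have h4 := hE.continuous_deriv le_rfl
  exact continuous_tangentFlow.comp (f := fun q : ℝ × ℝ =>
    (((P₀ q.1, E₀ q.1), (deriv P₀ q.1, deriv E₀ q.1)), q.2)) (by fun_prop)

/-- The times `s` and `t` are in arbitrary order: the estimate bounds growth, and read backwards it
also prevents a nonzero solution from decaying faster than exponentially. -/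
theorem norm_charD_le (x s t : ℝ) :
    ‖(charDP P₀ E₀ x t, charDE P₀ E₀ x t)‖ ≤
      ‖(charDP P₀ E₀ x s, charDE P₀ E₀ x s)‖ * Real.exp |t - s| := by
  refine norm_le_norm_mul_exp (f := fun t => (charDP P₀ E₀ x t, charDE P₀ E₀ x t))
    (fun t => (hasDerivAt_charDP x t).prodMk (hasDerivAt_charDE x t)) (fun t => ?_) s t
  simp only [Prod.norm_def, Real.norm_eq_abs, abs_neg]
  exact max_le (le_max_right _ _) (le_max_of_le_left (abs_velocityDeriv_mul_le _ _))

theorem norm_char_sub_le (x y t : ℝ) :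
    ‖(charP P₀ E₀ y t - charP P₀ E₀ x t, charE P₀ E₀ y t - charE P₀ E₀ x t)‖ ≤
      ‖(P₀ y - P₀ x, E₀ y - E₀ x)‖ * Real.exp |t| := by
  have := norm_le_norm_mul_exp
    (f := fun t => (charP P₀ E₀ y t - charP P₀ E₀ x t, charE P₀ E₀ y t - charE P₀ E₀ x t))
    (fun t => ((hasDerivAt_charP y t).sub (hasDerivAt_charP x t)).prodMk
      ((hasDerivAt_charE y t).sub (hasDerivAt_charE x t))) (fun t => ?_) 0 t
  · simpa only [charP_zero, charE_zero, sub_zero] using this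
  · simp only [Prod.norm_def, Real.norm_eq_abs]
    refine max_le (le_max_of_le_right ?_) (le_max_of_le_left (abs_velocity_sub_le _ _))
    rw [neg_sub_neg, abs_sub_comm]

/-- The state on a characteristic is differentiable in the starting point. -/
theorem hasDerivAt_char (hP : ContDiff ℝ 1 P₀) (hE : ContDiff ℝ 1 E₀) (x t : ℝ) :
    HasDerivAt (fun y => (charP P₀ E₀ y t, charE P₀ E₀ y t))
      (charDP P₀ E₀ x t, charDE P₀ E₀ x t) x := by
  have hP' : HasDerivAt P₀ (deriv P₀ x) x := (hP.differentiable one_ne_zero x).hasDerivAt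
  have hE' : HasDerivAt E₀ (deriv E₀ x) x := (hE.differentiable one_ne_zero x).hasDerivAt
  have h0 : HasDerivAt (fun y => (P₀ y, E₀ y)) (deriv P₀ x, deriv E₀ x) x := hP'.prodMk hE'
  set D : ℝ → ℝ := fun y => ‖(P₀ y - P₀ x, E₀ y - E₀ x)‖ with hD
  set r : ℝ → ℝ → ℝ × ℝ := fun y s =>
    (charP P₀ E₀ y s - charP P₀ E₀ x s - (y - x) * charDP P₀ E₀ x s,
      charE P₀ E₀ y s - charE P₀ E₀ x s - (y - x) * charDE P₀ E₀ x s) with hr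
  -- The remainder `r` of the linearization satisfies the linearized system up to a quadratic error,
  -- so Grönwall bounds it by its initial value, which is `o(y - x)`, plus a multiple of `D y ^ 2`.
  have hbound : ∀ y, ‖r y t‖ ≤ ‖r y 0‖ * Real.exp |t| +
      3 * (D y * Real.exp |t|) ^ 2 * (Real.exp |t| - 1) := by
    intro y
    have := norm_le_gronwallBound_abs (f := r y) (K := 1) (T := |t|)
      (ε := 3 * (D y * Real.exp |t|) ^ 2) (t := t)
      (fun s _ => (((hasDerivAt_charP y s).sub (hasDerivAt_charP x s)).sub
        ((hasDerivAt_charDP x s).const_mul (y - x))).prodMk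
        (((hasDerivAt_charE y s).sub (hasDerivAt_charE x s)).sub
        ((hasDerivAt_charDE x s).const_mul (y - x)))) (fun s hs => ?_) le_rfl
    · rw [gronwallBound_of_K_ne_0 one_ne_zero] at this
      simpa using this
    · have hεn : 0 ≤ 3 * (D y * Real.exp |t|) ^ 2 := by positivity
      rw [Prod.norm_def (r y s), one_mul, Prod.norm_def]
      refine max_le ?_ ?_
      · refine le_add_of_le_of_nonneg (le_max_of_le_right ?_) hεn
        simp only [hr, Real.norm_eq_abs]
        rw [← abs_neg]
        ring_nf
        exact le_rfl
      · simp only [hr, Real.norm_eq_abs]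
        set p := charP P₀ E₀ x s
        set q := charP P₀ E₀ y s
        set a := charDP P₀ E₀ x s
        have h1 := abs_velocity_sub_sub_le p q
        have h2 : |q - p| ≤ D y * Real.exp |t| := by
          have h := (norm_fst_le _).trans (norm_char_sub_le (P₀ := P₀) (E₀ := E₀) x y s)
          refine h.trans ?_
          gcongr
        have h3 : |q - p| ^ 2 ≤ (D y * Real.exp |t|) ^ 2 := by gcongr
        have h4 := abs_velocityDeriv_mul_le p (q - p - (y - x) * a)
        have h5 := abs_add_le (velocity q - velocity p - velocityDeriv p * (q - p))
          (velocityDeriv p * (q - p - (y - x) * a))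
        calc _ = |velocity q - velocity p - velocityDeriv p * (q - p) +
              velocityDeriv p * (q - p - (y - x) * a)| := by ring_nf
          _ ≤ |q - p - (y - x) * a| + 3 * (D y * Real.exp |t|) ^ 2 := by linarith
          _ ≤ _ := by gcongr; exact le_max_left _ _
  rw [hasDerivAt_iff_isLittleO] at h0 ⊢
  have hr0 : (fun y => r y 0) =o[𝓝 x] fun y => y - x := by
    refine h0.congr_left fun y => ?_
    simp [hr, charP_zero, charE_zero, charDP_zero, charDE_zero]
  have hDO : D =O[𝓝 x] fun y => y - x := by
    have h := (hP'.prodMk hE').isBigO_sub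
    exact h.norm_left
  have hsq : (fun y => D y ^ 2) =o[𝓝 x] fun y => y - x := by
    have h1 := hDO.pow 2
    refine h1.trans_isLittleO ?_
    have : (fun y : ℝ => (y - x) * (y - x)) =o[𝓝 x] fun y => 1 * (y - x) := by
      refine Asymptotics.IsLittleO.mul_isBigO ?_ (Asymptotics.isBigO_refl _ _)
      rw [Asymptotics.isLittleO_one_iff]
      have h : Continuous fun y : ℝ => y - x := by fun_prop
      simpa using h.tendsto x
    simpa [sq] using this
  have hsum : (fun y => ‖r y 0‖ * Real.exp |t| +
      3 * (D y * Real.exp |t|) ^ 2 * (Real.exp |t| - 1)) =o[𝓝 x] fun y => y - x := by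
    refine Asymptotics.IsLittleO.add ?_ ?_
    · have := hr0.norm_left.const_mul_left (Real.exp |t|)
      simpa [mul_comm] using this
    · have := hsq.const_mul_left (3 * Real.exp |t| ^ 2 * (Real.exp |t| - 1))
      refine this.congr_left fun y => by ring
  have hrt : (fun y => r y t) =o[𝓝 x] fun y => y - x := by
    refine Asymptotics.IsBigO.trans_isLittleO ?_ hsum
    refine Asymptotics.IsBigO.of_bound 1 (Eventually.of_forall fun y => ?_)
    rw [one_mul]
    exact (hbound y).trans (le_abs_self _)
  refine hrt.congr_left fun y => ?_
  simp [hr]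

end Lagrangian

/-! ### Oscillations and the drift of the phase -/

theorem le_sub_mul_of_hasDerivAt_le {G G' : ℝ → ℝ} {κ t₀ : ℝ}
    (hG : ∀ t, HasDerivAt G (G' t) t) (hG' : ∀ t, t₀ ≤ t → G' t ≤ -κ) {t : ℝ} (ht : t₀ ≤ t) :
    G t ≤ G t₀ - κ * (t - t₀) := by
  have hd : ∀ t, HasDerivAt (fun t => G t + κ * t) (G' t + κ) t := fun t => by
    have h := (hG t).add ((hasDerivAt_id t).const_mul κ)
    rw [mul_one] at h
    exact h
  have h := antitoneOn_of_hasDerivWithinAt_nonpos (convex_Ici t₀)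
    (fun t _ => (hd t).continuousAt.continuousWithinAt)
    (fun t _ => (hd t).hasDerivWithinAt)
    (fun t ht => by
      rw [interior_Ici] at ht
      linarith [hG' t (le_of_lt ht)])
  have := h self_mem_Ici ht ht
  simp only at this
  linarith

theorem mul_velocity_nonneg (p : ℝ) : 0 ≤ p * velocity p := by
  unfold velocity
  rw [← mul_div_assoc, ← sq]
  positivity

/-- This defect measures the nonlinearity of the oscillator. It would vanish for `V = P`, and it is
the source of the drift in `hasDerivAt_phase`. -/
theorem velocityDeriv_mul_sub (p : ℝ) : velocityDeriv p * p - velocity p = -velocity p ^ 3 := by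
  have h1 := one_le_sqrt_one_add_sq p
  have h2 := sq_sqrt_one_add_sq p
  unfold velocityDeriv velocity
  field_simp
  rw [h2]
  ring

/-- With `s = √(1 + p²) ≥ 1`: `2 (s - 1) ≤ (s + 1)(s - 1) = p² = s (p V) ≤ B (p V)`. -/
theorem two_mul_sqrt_sub_one_le {p B : ℝ} (hB : Real.sqrt (1 + p ^ 2) ≤ B) :
    2 * (Real.sqrt (1 + p ^ 2) - 1) ≤ B * (p * velocity p) := by
  have h1 := one_le_sqrt_one_add_sq p
  have h2 := sq_sqrt_one_add_sq p
  have h3 : Real.sqrt (1 + p ^ 2) * (p * velocity p) = p ^ 2 := by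
    unfold velocity
    field_simp
  have h4 := mul_le_mul_of_nonneg_right hB (mul_velocity_nonneg p)
  nlinarith

section Oscillation

variable {P E a b : ℝ → ℝ}

theorem energy_eq (hP : ∀ t, HasDerivAt P (-E t) t)
    (hE : ∀ t, HasDerivAt E (velocity (P t)) t) (t : ℝ) :
    energy (P t) (E t) = energy (P 0) (E 0) := by
  have hd : ∀ t, HasDerivAt (fun t => energy (P t) (E t)) 0 t := fun t => by
    have h := (((hasDerivAt_sqrt_one_add_sq (P t)).comp t (hP t)).const_mul 2).add ((hE t).pow 2)
    refine h.congr_deriv ?_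
    push_cast
    ring
  exact is_const_of_deriv_eq_zero (fun t => (hd t).differentiableAt) (fun t => (hd t).deriv) t 0

variable {k B : ℝ}

/-- A priori bounds along a trajectory of energy `2 + k`, with `B = 1 + k / 2`. -/
theorem bounds_of_energy_eq {p e : ℝ} (hk : energy p e = 2 + k) (hB : B = 1 + k / 2) :
    Real.sqrt (1 + p ^ 2) ≤ B ∧ |p| ≤ B ∧ |e| ≤ B ∧ k ≤ e ^ 2 + B * (p * velocity p) := by
  unfold energy at hk
  have h1 := one_le_sqrt_one_add_sq p
  have hs : Real.sqrt (1 + p ^ 2) ≤ B := by nlinarith [sq_nonneg e]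
  refine ⟨hs, (Real.abs_le_sqrt (by linarith)).trans hs, ?_, ?_⟩
  · refine abs_le_of_sq_le_sq ?_ (by linarith)
    nlinarith [sq_nonneg (B - 1)]
  · have := two_mul_sqrt_sub_one_le hs
    linarith

/-- A virial identity. Together with `k ≤ E² + B P V` it makes the bounded quantity `P E` decrease
at a definite rate whenever `P V` is small. -/
theorem hasDerivAt_mul_PE (hP : ∀ t, HasDerivAt P (-E t) t)
    (hE : ∀ t, HasDerivAt E (velocity (P t)) t) (t : ℝ) :
    HasDerivAt (fun t => P t * E t) (P t * velocity (P t) - E t ^ 2) t :=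
  ((hP t).mul (hE t)).congr_deriv (by ring)

/-- The velocity along a nontrivial trajectory keeps returning to values bounded away from zero,
of either sign `σ`. -/
theorem exists_le_velocity (hP : ∀ t, HasDerivAt P (-E t) t)
    (hE : ∀ t, HasDerivAt E (velocity (P t)) t) (hk0 : 0 < k) (hB : B = 1 + k / 2)
    (hk : ∀ t, energy (P t) (E t) = 2 + k) {σ : ℝ} (hσ : |σ| = 1) (t₀ : ℝ) :
    ∃ t, t₀ ≤ t ∧ k / (4 * ((1 + B) * B)) ≤ σ * velocity (P t) := by
  by_contra! hcon
  have hB1 : 1 < B := by linarith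
  -- Chosen so that `P E + (1 + B) B σ E`, a bounded function, would have derivative at most `-k /
  -- 2` if `σ V < c` held for all later times: the term in `σ V` cancels, leaving `2 c (1 + B) B -
  -- k`.
  set c := k / (4 * ((1 + B) * B)) with hc
  have hc0 : 0 < c := by positivity
  have hcB : (1 + B) * B * (2 * c) = k / 2 := by rw [hc]; field_simp; ring
  have hG := fun t => (hasDerivAt_mul_PE hP hE t).add ((hE t).const_mul ((1 + B) * B * σ))
  have hdec := fun t ht => le_sub_mul_of_hasDerivAt_le (κ := k / 2) (t₀ := t₀) (t := t) hG
    (fun t ht => by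
      obtain ⟨-, hp, -, hk'⟩ := bounds_of_energy_eq (hk t) hB
      have h1 := hcon t ht
      have h2 : |velocity (P t)| ≤ 2 * c - σ * velocity (P t) := by
        have : |velocity (P t)| = |σ * velocity (P t)| := by rw [abs_mul, hσ, one_mul]
        rw [this]
        exact abs_le.2 ⟨by linarith, by linarith⟩
      have h3 : P t * velocity (P t) ≤ B * (2 * c - σ * velocity (P t)) := by
        refine (le_abs_self _).trans ?_
        rw [abs_mul]
        exact mul_le_mul hp h2 (abs_nonneg _) (by linarith)
      have h4 := mul_le_mul_of_nonneg_left h3 (by linarith : 0 ≤ 1 + B)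
      nlinarith) ht
  have hbd : ∀ t, |P t * E t + (1 + B) * B * σ * E t| ≤ B * B + (1 + B) * B * B := fun t => by
    obtain ⟨-, hp, he, -⟩ := bounds_of_energy_eq (hk t) hB
    refine (abs_add_le _ _).trans (add_le_add ?_ ?_)
    · rw [abs_mul]; gcongr
    · rw [abs_mul, abs_mul, hσ, abs_of_pos (by positivity), mul_one]; gcongr
  set C := B * B + (1 + B) * B * B with hC
  have h1 := hdec (t₀ + 2 / k * (2 * C + 1)) (by
    have : 0 < 2 / k * (2 * C + 1) := by positivity
    linarith)
  have h2 := (abs_le.1 (hbd (t₀ + 2 / k * (2 * C + 1)))).1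
  have h3 := (abs_le.1 (hbd t₀)).2
  have h4 : k / 2 * (t₀ + 2 / k * (2 * C + 1) - t₀) = 2 * C + 1 := by field_simp; ring
  simp only [Pi.add_apply] at h1
  linarith

theorem hasDerivAt_linearized_energy (hP : ∀ t, HasDerivAt P (-E t) t)
    (hE : ∀ t, HasDerivAt E (velocity (P t)) t) (ha : ∀ t, HasDerivAt a (-b t) t)
    (hb : ∀ t, HasDerivAt b (velocityDeriv (P t) * a t) t) (t : ℝ) :
    HasDerivAt (fun t => velocity (P t) * a t + E t * b t) 0 t := by
  have h := (((hasDerivAt_velocity (P t)).comp t (hP t)).mul (ha t)).add ((hE t).mul (hb t))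
  refine h.congr_deriv ?_
  simp only [Function.comp_apply]
  ring

/-- The quotient is the coefficient `α` of `(a, b)` along the orbit's tangent `(-E, V)`. Since `V³ P
≥ 0`, its derivative has the sign opposite to that of `h`, or vanishes. -/
theorem hasDerivAt_phase (hP : ∀ t, HasDerivAt P (-E t) t)
    (hE : ∀ t, HasDerivAt E (velocity (P t)) t) (ha : ∀ t, HasDerivAt a (-b t) t)
    (hb : ∀ t, HasDerivAt b (velocityDeriv (P t) * a t) t) {t : ℝ}
    (hD : P t * velocity (P t) + E t ^ 2 ≠ 0) :
    HasDerivAt (fun t => (b t * P t - a t * E t) / (P t * velocity (P t) + E t ^ 2))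
      (-(velocity (P t) * a t + E t * b t) * (velocity (P t) ^ 3 * P t) /
        (P t * velocity (P t) + E t ^ 2) ^ 2) t := by
  have h := (((hb t).mul (hP t)).sub ((ha t).mul (hE t))).div
    (((hP t).mul ((hasDerivAt_velocity (P t)).comp t (hP t))).add ((hE t).pow 2)) hD
  refine h.congr_deriv ?_
  have key := velocityDeriv_mul_sub (P t)
  simp only [Function.comp_apply, Pi.mul_apply, Pi.sub_apply, Pi.add_apply, Pi.pow_apply]
  congr 1
  push_cast
  have hv : velocityDeriv (P t) * P t = velocity (P t) - velocity (P t) ^ 3 := by linarith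
  linear_combination (a t * (P t * velocity (P t) + E t ^ 2)
    + (b t * P t - a t * E t) * E t) * hv

/-- The component of a solution of the linearized system along the trajectory drifts to infinity
if the solution is transversal to the energy level. -/
theorem exists_forall_phase_le (hP : ∀ t, HasDerivAt P (-E t) t)
    (hE : ∀ t, HasDerivAt E (velocity (P t)) t) (ha : ∀ t, HasDerivAt a (-b t) t)
    (hb : ∀ t, HasDerivAt b (velocityDeriv (P t) * a t) t) (hk0 : 0 < k) (hB : B = 1 + k / 2)
    (hk : ∀ t, energy (P t) (E t) = 2 + k) {h : ℝ} (hh0 : h ≠ 0)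
    (hh : ∀ t, velocity (P t) * a t + E t * b t = h) (N : ℝ) :
    ∃ t₀, 0 ≤ t₀ ∧ ∀ t, t₀ ≤ t →
      h * ((b t * P t - a t * E t) / (P t * velocity (P t) + E t ^ 2)) ≤ -N := by
  have hB1 : 1 < B := by linarith
  have hD : ∀ t, 0 < P t * velocity (P t) + E t ^ 2 := fun t => by
    obtain ⟨-, -, -, hk'⟩ := bounds_of_energy_eq (hk t) hB
    have := mul_velocity_nonneg (P t)
    nlinarith [sq_nonneg (E t)]
  have hDle : ∀ t, P t * velocity (P t) + E t ^ 2 ≤ B + B ^ 2 := fun t => by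
    obtain ⟨-, hp, he, -⟩ := bounds_of_energy_eq (hk t) hB
    refine add_le_add ?_ ?_
    · refine (le_abs_self _).trans ?_
      rw [abs_mul]
      exact (mul_le_of_le_one_right (abs_nonneg _) (abs_velocity_le_one _)).trans hp
    · rw [← sq_abs]; gcongr
  -- `η`, `L` and `K` are tuned so that `P E + K h α` has derivative at most `-k / 2`: values `P V ≤
  -- η` cost at most `k / 2` of the virial gain `k`, and larger ones are absorbed by the drift of `K
  -- h α`.
  set η := k / (2 * (1 + B)) with hη
  have hη0 : 0 < η := by positivity
  have hηB : (1 + B) * η = k / 2 := by rw [hη]; field_simp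
  set L := (1 + B) * B ^ 2 / η ^ 2 with hL
  have hL0 : 0 < L := by positivity
  set K := L * (B + B ^ 2) ^ 2 / h ^ 2 with hK
  have hK0 : 0 < K := by positivity
  have hG := fun t => (hasDerivAt_mul_PE hP hE t).add
    (((hasDerivAt_phase hP hE ha hb (hD t).ne').const_mul h).const_mul K)
  have hdec := fun t ht => le_sub_mul_of_hasDerivAt_le (κ := k / 2) (t₀ := 0) (t := t) hG
    (fun t _ => by
      obtain ⟨-, hp, -, hk'⟩ := bounds_of_energy_eq (hk t) hB
      rw [hh t]
      set x := P t * velocity (P t) with hx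
      have hx0 : 0 ≤ x := mul_velocity_nonneg (P t)
      have hDt := hD t
      have hDt' := hDle t
      set D := x + E t ^ 2 with hDdef
      have h1 : velocity (P t) ^ 3 * P t = x * velocity (P t) ^ 2 := by rw [hx]; ring
      have h2 : x ^ 2 ≤ B ^ 2 * velocity (P t) ^ 2 := by
        rw [hx, mul_pow, ← sq_abs (P t)]; gcongr
      have h3 : x ^ 3 ≤ B ^ 2 * (velocity (P t) ^ 3 * P t) := by
        rw [h1]; nlinarith
      -- The cube is what the drift controls, by `h3`.
      have h4 : x ≤ η + x ^ 3 / η ^ 2 := by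
        rw [← sub_le_iff_le_add', le_div_iff₀ (by positivity)]
        rcases le_total x η with hxη | hxη
        · have : (x - η) * η ^ 2 ≤ 0 := mul_nonpos_of_nonpos_of_nonneg (by linarith) (by positivity)
          have : 0 ≤ x ^ 3 := by positivity
          linarith
        · have h5 : η ^ 2 ≤ x ^ 2 := by gcongr
          calc (x - η) * η ^ 2 ≤ x * x ^ 2 := by gcongr; linarith
            _ = x ^ 3 := by ring
      have hw0 : 0 ≤ velocity (P t) ^ 3 * P t := by rw [h1]; positivity
      set w := velocity (P t) ^ 3 * P t with hw
      have h5 : (1 + B) * x ≤ k / 2 + L * w := by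
        have h6 : x ^ 3 / η ^ 2 ≤ B ^ 2 * w / η ^ 2 := by gcongr
        have h7 := mul_le_mul_of_nonneg_left (h4.trans (add_le_add_right h6 η))
          (by linarith : 0 ≤ 1 + B)
        calc (1 + B) * x ≤ _ := h7
          _ = (1 + B) * η + L * w := by rw [hL]; ring
          _ = _ := by rw [hηB]
      have h6 : K * (h * (-h * w / D ^ 2)) ≤ -(L * w) := by
        have e1 : K * (h * (-h * w / D ^ 2)) = -(L * w * ((B + B ^ 2) ^ 2 / D ^ 2)) := by
          rw [hK]; field_simp
        rw [e1, neg_le_neg_iff]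
        refine le_mul_of_one_le_right (by positivity) ?_
        rw [one_le_div (by positivity)]
        gcongr
      linarith) ht
  set α : ℝ → ℝ := fun t => (b t * P t - a t * E t) / (P t * velocity (P t) + E t ^ 2) with hα
  set R := 2 * B ^ 2 + K * |h * α 0| + K * |N| with hR
  have hR0 : 0 ≤ R := by positivity
  refine ⟨2 / k * R, by positivity, fun t ht => ?_⟩
  have ht0 : 0 ≤ t := le_trans (by positivity) ht
  have h1 := hdec t ht0
  simp only [Pi.add_apply] at h1
  change P t * E t + K * (h * α t) ≤ P 0 * E 0 + K * (h * α 0) - k / 2 * (t - 0) at h1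
  have hbd : ∀ t, |P t * E t| ≤ B ^ 2 := fun t => by
    obtain ⟨-, hp, he, -⟩ := bounds_of_energy_eq (hk t) hB
    rw [abs_mul, sq]; gcongr
  have h2 := (abs_le.1 (hbd t)).1
  have h3 := (abs_le.1 (hbd 0)).2
  have h4 : R ≤ k / 2 * t := by
    have := mul_le_mul_of_nonneg_left ht (by positivity : 0 ≤ k / 2)
    calc R = k / 2 * (2 / k * R) := by field_simp
      _ ≤ _ := this
  have h5 : K * (h * α t) ≤ K * (-N) := by
    have e1 := mul_le_mul_of_nonneg_left (le_abs_self (h * α 0)) hK0.le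
    have e2 := mul_le_mul_of_nonneg_left (le_abs_self N) hK0.le
    linarith
  exact le_of_mul_le_mul_left h5 hK0

/-- A solution of the linearized system that is transversal to the energy level has an unbounded
second component. -/
theorem exists_linearized_le (hP : ∀ t, HasDerivAt P (-E t) t)
    (hE : ∀ t, HasDerivAt E (velocity (P t)) t) (ha : ∀ t, HasDerivAt a (-b t) t)
    (hb : ∀ t, HasDerivAt b (velocityDeriv (P t) * a t) t)
    (h0 : velocity (P 0) * a 0 + E 0 * b 0 ≠ 0) (M : ℝ) : ∃ t, 0 ≤ t ∧ b t ≤ M := by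
  set h := velocity (P 0) * a 0 + E 0 * b 0 with hh
  have hhc : ∀ t, velocity (P t) * a t + E t * b t = h := fun t =>
    is_const_of_deriv_eq_zero
      (fun t => (hasDerivAt_linearized_energy hP hE ha hb t).differentiableAt)
      (fun t => (hasDerivAt_linearized_energy hP hE ha hb t).deriv) t 0
  obtain ⟨k, hk⟩ : ∃ k, energy (P 0) (E 0) = 2 + k := ⟨_, (add_sub_cancel _ _).symm⟩
  have hk0 : 0 < k := by
    unfold energy at hk
    have h1 := one_le_sqrt_one_add_sq (P 0)
    have h2 := sq_sqrt_one_add_sq (P 0)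
    -- Energy at most 2 means the rest state `P = E = 0`, where `h` would vanish.
    by_contra! hle
    have hE0 : E 0 = 0 := by
      rw [← sq_eq_zero_iff]; nlinarith [sq_nonneg (E 0)]
    have hs : Real.sqrt (1 + P 0 ^ 2) = 1 := by nlinarith [sq_nonneg (E 0)]
    have hP0 : P 0 = 0 := by
      rw [← sq_eq_zero_iff]; rw [hs] at h2; linarith
    exact h0 (by rw [hh, hE0, hP0]; simp [velocity])
  have hk' : ∀ t, energy (P t) (E t) = 2 + k := fun t => (energy_eq hP hE t).trans hk
  obtain ⟨B, hB⟩ : ∃ B, B = 1 + k / 2 := ⟨_, rfl⟩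
  have hB1 : 1 < B := by linarith
  set c := k / (4 * ((1 + B) * B)) with hc
  have hc0 : 0 < c := by positivity
  have hh0 : 0 < |h| := abs_pos.2 h0
  -- Makes `α V` outweigh both the transversal term `h E / D`, which is at most `|h| B² / k`, and
  -- `M`, once `σ V ≥ c`.
  set N := |h| / c * (|h| * B ^ 2 / k + |M|) with hN
  have hN0 : 0 ≤ N := by positivity
  obtain ⟨t₀, ht₀, hph⟩ := exists_forall_phase_le hP hE ha hb hk0 hB hk' h0 hhc N
  obtain ⟨σ, hσ, hσh⟩ : ∃ σ : ℝ, |σ| = 1 ∧ h = |h| * σ := by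
    rcases h0.lt_or_gt with hneg | hpos
    · exact ⟨-1, by simp, by rw [abs_of_neg hneg]; ring⟩
    · exact ⟨1, by simp, by rw [abs_of_pos hpos]; ring⟩
  obtain ⟨t, ht, hV⟩ := exists_le_velocity hP hE hk0 hB hk' hσ t₀
  refine ⟨t, ht₀.trans ht, ?_⟩
  have hα := hph t ht
  obtain ⟨-, hp, he, hkB⟩ := bounds_of_energy_eq (hk' t) hB
  have hx0 := mul_velocity_nonneg (P t)
  have hD : k ≤ B * (P t * velocity (P t) + E t ^ 2) := by nlinarith [sq_nonneg (E t)]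
  have hD0 : 0 < P t * velocity (P t) + E t ^ 2 := by
    by_contra! hle
    nlinarith
  set D := P t * velocity (P t) + E t ^ 2 with hDdef
  set α := (b t * P t - a t * E t) / D with hαdef
  -- Second component of the splitting of `(a, b)` along `(-E, V)` and `(P, E)`.
  have hbt : b t = α * velocity (P t) + h * E t / D := by
    rw [hαdef, ← hhc t]
    field_simp
    rw [hDdef]
    ring
  have h1 : σ * σ = 1 := by rw [← abs_mul_abs_self, hσ]; norm_num
  have h2 : α * velocity (P t) ≤ -(|h| * B ^ 2 / k + |M|) := by
    have e1 : |h| * (σ * α) ≤ -N := by rw [← mul_assoc, ← hσh]; exact hα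
    have e2 : σ * α ≤ -(N / |h|) := by
      rw [← neg_div, le_div_iff₀ hh0]; linarith
    have e3 : (σ * α) * (σ * velocity (P t)) ≤ -(N / |h|) * c := by
      have e4 : 0 ≤ N / |h| := by positivity
      nlinarith
    have e5 : (σ * α) * (σ * velocity (P t)) = α * velocity (P t) := by
      linear_combination (α * velocity (P t)) * h1
    have e6 : N / |h| * c = |h| * B ^ 2 / k + |M| := by rw [hN]; field_simp
    linarith
  have h3 : h * E t / D ≤ |h| * B ^ 2 / k := by
    refine (le_abs_self _).trans ?_
    rw [abs_div, abs_mul, abs_of_pos hD0, div_le_div_iff₀ hD0 hk0]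
    calc |h| * |E t| * k ≤ |h| * B * (B * D) := by gcongr
      _ = _ := by ring
  have := neg_abs_le M
  linarith

end Oscillation

/-! ### Joint differentiability from continuous partial derivatives -/

section Partials

variable {f f₁ f₂ : ℝ → ℝ → ℝ}

theorem hasFDerivAt_of_continuous_partials (h₁ : ∀ x t, HasDerivAt (fun y => f y t) (f₁ x t) x)
    (h₂ : ∀ x t, HasDerivAt (f x) (f₂ x t) t) (c₁ : Continuous fun q : ℝ × ℝ => f₁ q.1 q.2)
    (c₂ : Continuous fun q : ℝ × ℝ => f₂ q.1 q.2) (q : ℝ × ℝ) :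
    HasFDerivAt (fun q : ℝ × ℝ => f q.1 q.2)
      (f₁ q.1 q.2 • ContinuousLinearMap.fst ℝ ℝ ℝ + f₂ q.1 q.2 • ContinuousLinearMap.snd ℝ ℝ ℝ)
      q := by
  have key := hasStrictFDerivAt_uncurry_coprod (𝕜 := ℝ) (u := q) (f := f)
    (f₁ := fun x t => f₁ x t • ContinuousLinearMap.id ℝ ℝ)
    (f₂ := fun x t => f₂ x t • ContinuousLinearMap.id ℝ ℝ)
    (Eventually.of_forall fun v => by
      refine (h₁ v.1 v.2).hasFDerivAt.congr_fderiv ?_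
      ext; simp [Function.HasUncurry.uncurry])
    (Eventually.of_forall fun v => by
      refine (h₂ v.1 v.2).hasFDerivAt.congr_fderiv ?_
      ext; simp [Function.HasUncurry.uncurry])
    (c₁.smul continuous_const).continuousAt (c₂.smul continuous_const).continuousAt
  refine key.hasFDerivAt.congr_fderiv ?_
  ext <;> simp [Function.HasUncurry.uncurry]

theorem contDiff_one_of_continuous_partials
    (h₁ : ∀ x t, HasDerivAt (fun y => f y t) (f₁ x t) x)
    (h₂ : ∀ x t, HasDerivAt (f x) (f₂ x t) t) (c₁ : Continuous fun q : ℝ × ℝ => f₁ q.1 q.2)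
    (c₂ : Continuous fun q : ℝ × ℝ => f₂ q.1 q.2) :
    ContDiff ℝ 1 fun q : ℝ × ℝ => f q.1 q.2 :=
  contDiff_one_iff_hasFDerivAt.2 ⟨_, by fun_prop, hasFDerivAt_of_continuous_partials h₁ h₂ c₁ c₂⟩

end Partials

/-! ### Characteristics and `C¹` solutions -/

/-- The position at time `t` of the characteristic starting at `x`. -/
noncomputable def charX (P₀ E₀ : ℝ → ℝ) (x t : ℝ) : ℝ := x - E₀ x + charE P₀ E₀ x t

/-- The derivative of `charX` with respect to the starting point. -/
noncomputable def charJ (P₀ E₀ : ℝ → ℝ) (x t : ℝ) : ℝ := 1 - deriv E₀ x + charDE P₀ E₀ x t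

section Characteristics

variable {P₀ E₀ : ℝ → ℝ}

theorem charX_zero (x : ℝ) : charX P₀ E₀ x 0 = x := by simp [charX, charE_zero]

theorem charJ_zero (x : ℝ) : charJ P₀ E₀ x 0 = 1 := by simp [charJ, charDE_zero]

theorem hasDerivAt_charX_time (x t : ℝ) :
    HasDerivAt (charX P₀ E₀ x) (velocity (charP P₀ E₀ x t)) t :=
  (hasDerivAt_charE x t).const_add _

theorem hasDerivAt_charJ (x t : ℝ) :
    HasDerivAt (charJ P₀ E₀ x) (velocityDeriv (charP P₀ E₀ x t) * charDP P₀ E₀ x t) t :=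
  (hasDerivAt_charDE x t).const_add _

theorem abs_charX_sub_le (x t : ℝ) : |charX P₀ E₀ x t - x| ≤ |t| := by
  have := convex_univ.norm_image_sub_le_of_norm_hasDerivWithin_le (f := charX P₀ E₀ x)
    (C := 1) (x := 0) (y := t) (fun s _ => (hasDerivAt_charX_time x s).hasDerivWithinAt)
    (fun s _ => abs_velocity_le_one _) (mem_univ _) (mem_univ _)
  simpa [charX_zero] using this

variable (hP : ContDiff ℝ 1 P₀) (hE : ContDiff ℝ 1 E₀)

section
include hP hE

theorem hasDerivAt_charP_space (x t : ℝ) :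
    HasDerivAt (fun y => charP P₀ E₀ y t) (charDP P₀ E₀ x t) x :=
  (hasDerivAt_char hP hE x t).fst

theorem hasDerivAt_charE_space (x t : ℝ) :
    HasDerivAt (fun y => charE P₀ E₀ y t) (charDE P₀ E₀ x t) x :=
  (hasDerivAt_char hP hE x t).snd

theorem hasDerivAt_charX_space (x t : ℝ) :
    HasDerivAt (fun y => charX P₀ E₀ y t) (charJ P₀ E₀ x t) x :=
  ((hasDerivAt_id x).sub (hE.differentiable one_ne_zero x).hasDerivAt).add
    (hasDerivAt_charE_space hP hE x t)

theorem continuous_charP : Continuous fun q : ℝ × ℝ => charP P₀ E₀ q.1 q.2 :=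
  (continuous_lagrangian hP hE).fst.fst

theorem continuous_charE : Continuous fun q : ℝ × ℝ => charE P₀ E₀ q.1 q.2 :=
  (continuous_lagrangian hP hE).fst.snd

theorem continuous_charDP : Continuous fun q : ℝ × ℝ => charDP P₀ E₀ q.1 q.2 :=
  (continuous_lagrangian hP hE).snd.fst

theorem continuous_charDE : Continuous fun q : ℝ × ℝ => charDE P₀ E₀ q.1 q.2 :=
  (continuous_lagrangian hP hE).snd.snd

theorem continuous_charJ : Continuous fun q : ℝ × ℝ => charJ P₀ E₀ q.1 q.2 :=
  (continuous_const.sub ((hE.continuous_deriv le_rfl).comp continuous_fst)).add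
    (continuous_charDE hP hE)

theorem continuous_velocity_charP : Continuous fun q : ℝ × ℝ => velocity (charP P₀ E₀ q.1 q.2) :=
  (contDiff_velocity (n := 1)).continuous.comp (continuous_charP hP hE)

theorem contDiff_charP : ContDiff ℝ 1 fun q : ℝ × ℝ => charP P₀ E₀ q.1 q.2 :=
  contDiff_one_of_continuous_partials (hasDerivAt_charP_space hP hE) hasDerivAt_charP
    (continuous_charDP hP hE) (continuous_charE hP hE).neg

theorem contDiff_charE : ContDiff ℝ 1 fun q : ℝ × ℝ => charE P₀ E₀ q.1 q.2 :=
  contDiff_one_of_continuous_partials (hasDerivAt_charE_space hP hE) hasDerivAt_charE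
    (continuous_charDE hP hE) (continuous_velocity_charP hP hE)

theorem contDiff_charX : ContDiff ℝ 1 fun q : ℝ × ℝ => charX P₀ E₀ q.1 q.2 :=
  contDiff_one_of_continuous_partials (hasDerivAt_charX_space hP hE) hasDerivAt_charX_time
    (continuous_charJ hP hE) (continuous_velocity_charP hP hE)

theorem hasFDerivAt_charX (q : ℝ × ℝ) :
    HasFDerivAt (fun q : ℝ × ℝ => charX P₀ E₀ q.1 q.2)
      (charJ P₀ E₀ q.1 q.2 • ContinuousLinearMap.fst ℝ ℝ ℝ +
        velocity (charP P₀ E₀ q.1 q.2) • ContinuousLinearMap.snd ℝ ℝ ℝ) q :=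
  hasFDerivAt_of_continuous_partials (hasDerivAt_charX_space hP hE) hasDerivAt_charX_time
    (continuous_charJ hP hE) (continuous_velocity_charP hP hE) q

end

/-- Chain rule for a function of position and time along a characteristic. -/
theorem hasDerivAt_comp_char_time {Q : ℝ × ℝ → ℝ} {x t : ℝ}
    (hQ : DifferentiableAt ℝ Q (charX P₀ E₀ x t, t)) :
    HasDerivAt (fun s => Q (charX P₀ E₀ x s, s))
      (deriv (fun s => Q (charX P₀ E₀ x t, s)) t +
        velocity (charP P₀ E₀ x t) * deriv (fun r => Q (r, t)) (charX P₀ E₀ x t)) t := by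
  have h1 : HasDerivAt (fun s => Q (charX P₀ E₀ x t, s)) _ t :=
    hQ.hasFDerivAt.comp_hasDerivAt t ((hasDerivAt_const t _).prodMk (hasDerivAt_id t))
  have h2 : HasDerivAt (fun r => Q (r, t)) _ (charX P₀ E₀ x t) :=
    hQ.hasFDerivAt.comp_hasDerivAt (charX P₀ E₀ x t)
      ((hasDerivAt_id _).prodMk (hasDerivAt_const _ t))
  have h3 : HasDerivAt (fun s => Q (charX P₀ E₀ x s, s)) _ t :=
    HasFDerivAt.comp_hasDerivAt (f := fun s => (charX P₀ E₀ x s, s)) t hQ.hasFDerivAt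
      ((hasDerivAt_charX_time x t).prodMk (hasDerivAt_id t))
  rw [h1.deriv, h2.deriv]
  refine h3.congr_deriv ?_
  rw [← smul_eq_mul, ← map_smul, ← map_add]
  simp

/-- Chain rule for a function of position and time across the characteristics. -/
theorem hasDerivAt_comp_char_space (hP : ContDiff ℝ 1 P₀) (hE : ContDiff ℝ 1 E₀)
    {Q : ℝ × ℝ → ℝ} {x t : ℝ} (hQ : DifferentiableAt ℝ Q (charX P₀ E₀ x t, t)) :
    HasDerivAt (fun y => Q (charX P₀ E₀ y t, t))
      (deriv (fun r => Q (r, t)) (charX P₀ E₀ x t) * charJ P₀ E₀ x t) x := by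
  have h2 : HasDerivAt (fun r => Q (r, t)) _ (charX P₀ E₀ x t) :=
    hQ.hasFDerivAt.comp_hasDerivAt (charX P₀ E₀ x t)
      ((hasDerivAt_id _).prodMk (hasDerivAt_const _ t))
  exact h2.differentiableAt.hasDerivAt.comp x (hasDerivAt_charX_space hP hE x t)

theorem strip_mem_nhds {T t : ℝ} (ht : t ∈ Ioo 0 T) (ρ : ℝ) :
    (univ : Set ℝ) ×ˢ Ico 0 T ∈ 𝓝 (ρ, t) :=
  prod_mem_nhds univ_mem (Ico_mem_nhds ht.1 ht.2)

theorem differentiableAt_of_contDiffOn_strip {T : ℝ} {Q : ℝ × ℝ → ℝ}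
    (hQ : ContDiffOn ℝ 1 Q (univ ×ˢ Ico 0 T)) {t : ℝ} (ht : t ∈ Ioo 0 T) (ρ : ℝ) :
    DifferentiableAt ℝ Q (ρ, t) :=
  (hQ.contDiffAt (strip_mem_nhds ht ρ)).differentiableAt one_ne_zero

/-- Being `C¹` up to time 0 makes the derivative within the strip continuous on the compact arc, so
the bound does not degenerate as `s` tends to 0. It feeds the Grönwall argument for uniqueness. -/
theorem exists_abs_deriv_comp_char_le {T : ℝ} {Q : ℝ × ℝ → ℝ}
    (hQ : ContDiffOn ℝ 1 Q (univ ×ˢ Ico 0 T)) (x : ℝ) {t : ℝ} (ht : t < T) :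
    ∃ C, ∀ s ∈ Ioc 0 t, |deriv (fun r => Q (r, s)) (charX P₀ E₀ x s)| ≤ C := by
  have hu : UniqueDiffOn ℝ ((univ : Set ℝ) ×ˢ Ico 0 T) := uniqueDiffOn_univ.prod
    (uniqueDiffOn_Ico 0 T)
  have hcX : Continuous (charX P₀ E₀ x) :=
    continuous_iff_continuousAt.2 fun s => (hasDerivAt_charX_time x s).continuousAt
  have hc : ContinuousOn (fun s => fderivWithin ℝ Q (univ ×ˢ Ico 0 T) (charX P₀ E₀ x s, s))
      (Icc 0 t) :=
    (hQ.continuousOn_fderivWithin hu le_rfl).comp (by fun_prop)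
      fun s hs => ⟨mem_univ _, hs.1, hs.2.trans_lt ht⟩
  obtain ⟨C, hC⟩ := isCompact_Icc.exists_bound_of_continuousOn hc
  refine ⟨C, fun s hs => ?_⟩
  have hs' : s ∈ Ioo 0 T := ⟨hs.1, hs.2.trans_lt ht⟩
  have h1 := hC s ⟨hs.1.le, hs.2⟩
  rw [fderivWithin_of_mem_nhds (strip_mem_nhds hs' _)] at h1
  have h2 : HasDerivAt (fun r => Q (r, s)) _ (charX P₀ E₀ x s) :=
    (differentiableAt_of_contDiffOn_strip hQ hs' _).hasFDerivAt.comp_hasDerivAt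
      (charX P₀ E₀ x s) ((hasDerivAt_id _).prodMk (hasDerivAt_const _ s))
  rw [h2.deriv]
  refine (ContinuousLinearMap.le_of_opNorm_le _ h1 _).trans ?_
  simp [Prod.norm_def]

/-- Every `C¹` solution is transported along the characteristics. -/
theorem IsC1Solution.eq_char {T : ℝ} {Q F : ℝ × ℝ → ℝ} (h : IsC1Solution P₀ E₀ T Q F) (x : ℝ)
    {t : ℝ} (ht : t ∈ Ico 0 T) :
    Q (charX P₀ E₀ x t, t) = charP P₀ E₀ x t ∧ F (charX P₀ E₀ x t, t) = charE P₀ E₀ x t := by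
  obtain ⟨C₁, hC₁⟩ := exists_abs_deriv_comp_char_le (P₀ := P₀) (E₀ := E₀) h.contDiffOn_P x ht.2
  obtain ⟨C₂, hC₂⟩ := exists_abs_deriv_comp_char_le (P₀ := P₀) (E₀ := E₀) h.contDiffOn_E x ht.2
  set C := |C₁| + |C₂| with hC
  have hC0 : 0 ≤ C := by positivity
  set d : ℝ → ℝ × ℝ := fun s => (Q (charX P₀ E₀ x s, s) - charP P₀ E₀ x s,
    F (charX P₀ E₀ x s, s) - charE P₀ E₀ x s) with hd
  have hcX : Continuous (charX P₀ E₀ x) :=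
    continuous_iff_continuousAt.2 fun s => (hasDerivAt_charX_time x s).continuousAt
  have hcP : Continuous (charP P₀ E₀ x) :=
    continuous_iff_continuousAt.2 fun s => (hasDerivAt_charP x s).continuousAt
  have hcE : Continuous (charE P₀ E₀ x) :=
    continuous_iff_continuousAt.2 fun s => (hasDerivAt_charE x s).continuousAt
  have hmaps : MapsTo (fun s => (charX P₀ E₀ x s, s)) (Icc 0 t) (univ ×ˢ Ico 0 T) :=
    fun s hs => ⟨mem_univ _, hs.1, hs.2.trans_lt ht.2⟩
  have hcd : ContinuousOn d (Icc 0 t) :=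
    ((h.contDiffOn_P.continuousOn.comp (by fun_prop) hmaps).sub hcP.continuousOn).prodMk
      ((h.contDiffOn_E.continuousOn.comp (by fun_prop) hmaps).sub hcE.continuousOn)
  set d' : ℝ → ℝ × ℝ := fun s =>
    (deriv (fun r => Q (charX P₀ E₀ x s, r)) s + velocity (charP P₀ E₀ x s) *
        deriv (fun r => Q (r, s)) (charX P₀ E₀ x s) - -charE P₀ E₀ x s,
      deriv (fun r => F (charX P₀ E₀ x s, r)) s + velocity (charP P₀ E₀ x s) *
        deriv (fun r => F (r, s)) (charX P₀ E₀ x s) - velocity (charP P₀ E₀ x s)) with hd'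
  have hder : ∀ s ∈ Ioc 0 t, HasDerivAt d (d' s) s := fun s hs => by
    have hs' : s ∈ Ioo 0 T := ⟨hs.1, hs.2.trans_lt ht.2⟩
    exact ((hasDerivAt_comp_char_time
        (differentiableAt_of_contDiffOn_strip h.contDiffOn_P hs' _)).sub
        (hasDerivAt_charP x s)).prodMk
      ((hasDerivAt_comp_char_time
        (differentiableAt_of_contDiffOn_strip h.contDiffOn_E hs' _)).sub (hasDerivAt_charE x s))
  have hbound : ∀ s ∈ Ioc 0 t, ‖d' s‖ ≤ (C + 1) * ‖d s‖ := fun s hs => by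
    have hs' : s ∈ Ioo 0 T := ⟨hs.1, hs.2.trans_lt ht.2⟩
    have e1 := h.eq_P (charX P₀ E₀ x s) s hs'
    have e2 := h.eq_E (charX P₀ E₀ x s) s hs'
    have b1 := (hC₁ s hs).trans (le_abs_self _)
    have b2 := (hC₂ s hs).trans (le_abs_self _)
    have n1 : |Q (charX P₀ E₀ x s, s) - charP P₀ E₀ x s| ≤ ‖d s‖ := norm_fst_le (d s)
    have n2 : |F (charX P₀ E₀ x s, s) - charE P₀ E₀ x s| ≤ ‖d s‖ := norm_snd_le (d s)
    have hv := abs_velocity_sub_le (charP P₀ E₀ x s) (Q (charX P₀ E₀ x s, s))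
    rw [Prod.norm_def (d' s)]
    simp only [hd', Real.norm_eq_abs]
    set p := charP P₀ E₀ x s
    set q := Q (charX P₀ E₀ x s, s)
    set Qr := deriv (fun r => Q (r, s)) (charX P₀ E₀ x s)
    set Fr := deriv (fun r => F (r, s)) (charX P₀ E₀ x s)
    have hv' : |velocity q - velocity p| ≤ ‖d s‖ := hv.trans n1
    have m1 : |(velocity q - velocity p) * Qr| ≤ ‖d s‖ * C := by
      rw [abs_mul]
      exact mul_le_mul hv' (by linarith [abs_nonneg C₂]) (abs_nonneg _) (norm_nonneg _)
    have m2 : |(velocity q - velocity p) * Fr| ≤ ‖d s‖ * C := by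
      rw [abs_mul]
      exact mul_le_mul hv' (by linarith [abs_nonneg C₁]) (abs_nonneg _) (norm_nonneg _)
    refine max_le ?_ ?_
    · calc _ = |-((velocity q - velocity p) * Qr) -
            (F (charX P₀ E₀ x s, s) - charE P₀ E₀ x s)| := by
              congr 1; linear_combination e1
        _ ≤ _ := abs_sub _ _
        _ ≤ _ := by rw [abs_neg]; linarith
    · calc _ = |-((velocity q - velocity p) * Fr) + (velocity q - velocity p)| := by
              congr 1; linear_combination e2
        _ ≤ _ := abs_add_le _ _
        _ ≤ _ := by rw [abs_neg]; linarith
  have hd0 : d 0 = 0 := by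
    simp [hd, charX_zero, charP_zero, charE_zero, h.init_P, h.init_E]
  have hzero : d t = 0 := by
    rcases ht.1.eq_or_lt with rfl | htpos
    · exact hd0
    -- The equations hold only at positive times, so Grönwall starts at `r > 0`; then `r` tends to
    -- 0, where `d` is continuous and vanishes.
    have hle : ∀ r ∈ Ioo 0 t, ‖d t‖ ≤ ‖d r‖ * Real.exp ((C + 1) * t) := fun r hr => by
      have := norm_le_gronwallBound_of_norm_deriv_right_le (f := d) (f' := d') (δ := ‖d r‖)
        (K := C + 1) (ε := 0) (a := r) (b := t)
        (hcd.mono (Icc_subset_Icc_left hr.1.le))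
        (fun s hs => (hder s ⟨hr.1.trans_le hs.1, hs.2.le⟩).hasDerivWithinAt) le_rfl
        (fun s hs => by simpa using hbound s ⟨hr.1.trans_le hs.1, hs.2.le⟩) t ⟨hr.2.le, le_rfl⟩
      rw [gronwallBound_ε0] at this
      refine this.trans ?_
      gcongr
      linarith [hr.1]
    have hlim : Tendsto (fun r => ‖d r‖ * Real.exp ((C + 1) * t)) (𝓝[>] 0) (𝓝 0) := by
      have h1 : Tendsto d (𝓝[>] 0) (𝓝 (d 0)) := by
        have := hcd 0 ⟨le_rfl, htpos.le⟩
        rw [← nhdsWithin_Ioo_eq_nhdsGT htpos]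
        exact this.mono Ioo_subset_Icc_self
      have := h1.norm.mul_const (Real.exp ((C + 1) * t))
      rwa [hd0, norm_zero, zero_mul] at this
    have : ‖d t‖ ≤ 0 := ge_of_tendsto hlim (by
      filter_upwards [Ioo_mem_nhdsGT htpos] with r hr using hle r hr)
    exact norm_le_zero_iff.1 this
  have h1 := congrArg Prod.fst hzero
  have h2 := congrArg Prod.snd hzero
  exact ⟨sub_eq_zero.1 h1, sub_eq_zero.1 h2⟩

/-- The spatial derivatives of a `C¹` solution, computed on characteristics. -/
theorem IsC1Solution.deriv_mul_charJ (hP : ContDiff ℝ 1 P₀) (hE : ContDiff ℝ 1 E₀) {T : ℝ}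
    {Q F : ℝ × ℝ → ℝ} (h : IsC1Solution P₀ E₀ T Q F) (x : ℝ) {t : ℝ} (ht : t ∈ Ioo 0 T) :
    deriv (fun r => Q (r, t)) (charX P₀ E₀ x t) * charJ P₀ E₀ x t = charDP P₀ E₀ x t ∧
      deriv (fun r => F (r, t)) (charX P₀ E₀ x t) * charJ P₀ E₀ x t = charDE P₀ E₀ x t := by
  have ht' : t ∈ Ico 0 T := ⟨ht.1.le, ht.2⟩
  constructor
  · have h1 := hasDerivAt_comp_char_space hP hE (x := x)
      (differentiableAt_of_contDiffOn_strip h.contDiffOn_P ht (charX P₀ E₀ x t))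
    rw [funext fun y => (h.eq_char y ht').1] at h1
    exact h1.unique (hasDerivAt_charP_space hP hE x t)
  · have h1 := hasDerivAt_comp_char_space hP hE (x := x)
      (differentiableAt_of_contDiffOn_strip h.contDiffOn_E ht (charX P₀ E₀ x t))
    rw [funext fun y => (h.eq_char y ht').2] at h1
    exact h1.unique (hasDerivAt_charE_space hP hE x t)

/-- A solution of the linearized system that vanishes once vanishes always, so `E₀' = 0` at `x` too.
-/
theorem charJ_eq_one_of_charD_eq_zero {x t : ℝ} (h₁ : charDP P₀ E₀ x t = 0)
    (h₂ : charDE P₀ E₀ x t = 0) : charJ P₀ E₀ x t = 1 := by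
  have h := norm_charD_le (P₀ := P₀) (E₀ := E₀) x t 0
  rw [h₁, h₂, Prod.mk_zero_zero, norm_zero, zero_mul, norm_le_zero_iff, charDE_zero] at h
  have h3 : deriv E₀ x = 0 := congrArg Prod.snd h
  rw [charJ, h₂, h3]
  norm_num

/-- On the lifespan of a `C¹` solution, characteristics do not meet. -/
theorem IsC1Solution.charJ_pos (hP : ContDiff ℝ 1 P₀) (hE : ContDiff ℝ 1 E₀) {T : ℝ}
    {Q F : ℝ × ℝ → ℝ} (h : IsC1Solution P₀ E₀ T Q F) (x : ℝ) {t : ℝ} (ht : t ∈ Ico 0 T) :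
    0 < charJ P₀ E₀ x t := by
  by_contra! hle
  have hc : Continuous (charJ P₀ E₀ x) :=
    continuous_iff_continuousAt.2 fun s => (hasDerivAt_charJ x s).continuousAt
  -- At a zero of `J` the finite derivatives of the solution force `(a, b) = 0`, hence `J = 1`.
  obtain ⟨s, hs, hs0⟩ := intermediate_value_Icc' ht.1 hc.continuousOn
    (show (0 : ℝ) ∈ Icc (charJ P₀ E₀ x t) (charJ P₀ E₀ x 0) from ⟨hle, by simp [charJ_zero]⟩)
  have hspos : 0 < s := by
    rcases hs.1.eq_or_lt with rfl | h0
    · simp [charJ_zero] at hs0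
    · exact h0
  have hd := h.deriv_mul_charJ hP hE x ⟨hspos, hs.2.trans_lt ht.2⟩
  rw [hs0, mul_zero, mul_zero] at hd
  have := charJ_eq_one_of_charD_eq_zero hd.1.symm hd.2.symm
  rw [hs0] at this
  exact zero_ne_one this

end Characteristics

/-! ### Existence while characteristics do not meet -/

/-- The starting point of the characteristic that passes through `ρ` at time `t`. -/
noncomputable def charInv (P₀ E₀ : ℝ → ℝ) (ρ t : ℝ) : ℝ :=
  Function.invFun (fun x => charX P₀ E₀ x t) ρ

section Existence

variable {P₀ E₀ : ℝ → ℝ}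

/-- Positive Jacobian gives strict monotonicity; speed at most 1 keeps `X` within `|t|` of `x`,
hence onto. -/
theorem charX_bijective (hP : ContDiff ℝ 1 P₀) (hE : ContDiff ℝ 1 E₀) {t : ℝ}
    (hJ : ∀ x, 0 < charJ P₀ E₀ x t) : Function.Bijective fun x => charX P₀ E₀ x t := by
  have hd := fun x => hasDerivAt_charX_space hP hE x t
  refine ⟨(strictMono_of_deriv_pos fun x => by rw [(hd x).deriv]; exact hJ x).injective, ?_⟩
  have hb := fun x => abs_le.1 (abs_charX_sub_le (P₀ := P₀) (E₀ := E₀) x t)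
  refine Continuous.surjective (continuous_iff_continuousAt.2 fun x => (hd x).continuousAt) ?_ ?_
  · refine tendsto_atTop_mono (f := fun x => x - |t|) (fun x => by linarith [(hb x).1]) ?_
    exact tendsto_atTop_add_const_right _ _ tendsto_id
  · refine tendsto_atBot_mono (f := fun x => x + |t|) (fun x => by linarith [(hb x).2]) ?_
    exact tendsto_atBot_add_const_right _ _ tendsto_id

theorem charInv_charX (hP : ContDiff ℝ 1 P₀) (hE : ContDiff ℝ 1 E₀) {t : ℝ}
    (hJ : ∀ x, 0 < charJ P₀ E₀ x t) (x : ℝ) : charInv P₀ E₀ (charX P₀ E₀ x t) t = x :=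
  Function.leftInverse_invFun (charX_bijective hP hE hJ).injective x

theorem charX_charInv (hP : ContDiff ℝ 1 P₀) (hE : ContDiff ℝ 1 E₀) {t : ℝ}
    (hJ : ∀ x, 0 < charJ P₀ E₀ x t) (ρ : ℝ) : charX P₀ E₀ (charInv P₀ E₀ ρ t) t = ρ :=
  Function.rightInverse_invFun (charX_bijective hP hE hJ).surjective ρ

/-- As long as characteristics do not meet, the starting point of a characteristic is a `C¹`
function of position and time. -/
theorem contDiffOn_charInv (hP : ContDiff ℝ 1 P₀) (hE : ContDiff ℝ 1 E₀) {T : ℝ}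
    (hJ : ∀ t ∈ Ico 0 T, ∀ x, 0 < charJ P₀ E₀ x t) :
    ContDiffOn ℝ 1 (fun q : ℝ × ℝ => charInv P₀ E₀ q.1 q.2) (univ ×ˢ Ico 0 T) := by
  rintro ⟨ρ, t⟩ ⟨-, ht⟩
  obtain ⟨x, rfl⟩ := (charX_bijective hP hE (hJ t ht)).surjective ρ
  -- Keeping time as a coordinate lets the inverse function theorem give joint regularity. As the
  -- flow exists for negative times too, `t = 0` is an interior point for `Φ`; only the comparison
  -- with `charInv` is confined to the strip.
  set Φ : ℝ × ℝ → ℝ × ℝ := fun q => (charX P₀ E₀ q.1 q.2, q.2) with hΦ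
  have hΦC : ContDiffAt ℝ 1 Φ (x, t) := ((contDiff_charX hP hE).prodMk contDiff_snd).contDiffAt
  set j := charJ P₀ E₀ x t with hj
  set v := velocity (charP P₀ E₀ x t) with hv
  have hj0 : j ≠ 0 := (hJ t ht x).ne'
  set L : (ℝ × ℝ) ≃L[ℝ] (ℝ × ℝ) := ContinuousLinearEquiv.equivOfInverse
    ((j • ContinuousLinearMap.fst ℝ ℝ ℝ + v • ContinuousLinearMap.snd ℝ ℝ ℝ).prod
      (ContinuousLinearMap.snd ℝ ℝ ℝ))
    ((j⁻¹ • ContinuousLinearMap.fst ℝ ℝ ℝ - (j⁻¹ * v) • ContinuousLinearMap.snd ℝ ℝ ℝ).prod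
      (ContinuousLinearMap.snd ℝ ℝ ℝ))
    (fun z => by ext <;> simp; field_simp; ring)
    (fun z => by ext <;> simp; field_simp; ring) with hL
  have hΦD : HasFDerivAt Φ (L : (ℝ × ℝ) →L[ℝ] (ℝ × ℝ)) (x, t) :=
    (hasFDerivAt_charX hP hE (x, t)).prodMk hasFDerivAt_snd
  set e := hΦC.toOpenPartialHomeomorph Φ hΦD one_ne_zero with he
  have hinv : ContDiffAt ℝ 1 e.symm (Φ (x, t)) := hΦC.to_localInverse hΦD one_ne_zero
  have htar : e.target ∈ 𝓝 (Φ (x, t)) :=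
    e.open_target.mem_nhds (hΦC.image_mem_toOpenPartialHomeomorph_target hΦD one_ne_zero)
  refine ContDiffWithinAt.congr_of_eventuallyEq (f := fun q => (e.symm q).1)
    (contDiff_fst.contDiffAt.comp _ hinv).contDiffWithinAt ?_ ?_
  · filter_upwards [self_mem_nhdsWithin, mem_nhdsWithin_of_mem_nhds htar]
    rintro ⟨ρ', t'⟩ ⟨-, ht'⟩ hmem
    have h1 : Φ (e.symm (ρ', t')) = (ρ', t') := e.right_inv hmem
    have h2 : (e.symm (ρ', t')).2 = t' := congrArg Prod.snd h1
    have h3 : charX P₀ E₀ (e.symm (ρ', t')).1 (e.symm (ρ', t')).2 = ρ' := congrArg Prod.fst h1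
    rw [h2] at h3
    calc charInv P₀ E₀ ρ' t' = charInv P₀ E₀ (charX P₀ E₀ (e.symm (ρ', t')).1 t') t' := by rw [h3]
      _ = (e.symm (ρ', t')).1 := charInv_charX hP hE (hJ t' ht') _
  · have h1 : e.symm (Φ (x, t)) = (x, t) :=
      e.left_inv (hΦC.mem_toOpenPartialHomeomorph_source hΦD one_ne_zero)
    change charInv P₀ E₀ (charX P₀ E₀ x t) t = (e.symm (Φ (x, t))).1
    rw [h1, charInv_charX hP hE (hJ t ht)]

/-- As long as characteristics do not meet, transport along them defines a `C¹` solution. -/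
theorem isC1Solution_of_charJ_pos (hP : ContDiff ℝ 1 P₀) (hE : ContDiff ℝ 1 E₀) {T : ℝ}
    (hT : 0 < T) (hJ : ∀ t ∈ Ico 0 T, ∀ x, 0 < charJ P₀ E₀ x t) :
    IsC1Solution P₀ E₀ T (fun q => charP P₀ E₀ (charInv P₀ E₀ q.1 q.2) q.2)
      (fun q => charE P₀ E₀ (charInv P₀ E₀ q.1 q.2) q.2) := by
  have hY := (contDiffOn_charInv hP hE hJ).prodMk contDiff_snd.contDiffOn
  have hCP := (contDiff_charP hP hE).comp_contDiffOn hY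
  have hCE := (contDiff_charE hP hE).comp_contDiffOn hY
  have hinv := fun t ht => charInv_charX hP hE (hJ t ht)
  have hzero : ∀ ρ, charInv P₀ E₀ ρ 0 = ρ := fun ρ => by
    have := hinv 0 ⟨le_rfl, hT⟩ ρ
    rwa [charX_zero] at this
  refine ⟨hCP, hCE, fun ρ t ht => ?_, fun ρ t ht => ?_, fun ρ => ?_, fun ρ => ?_⟩
  · obtain ⟨x, rfl⟩ := (charX_bijective hP hE (hJ t ⟨ht.1.le, ht.2⟩)).surjective ρ
    have h1 := hasDerivAt_comp_char_time (P₀ := P₀) (E₀ := E₀) (x := x)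
      (differentiableAt_of_contDiffOn_strip hCP ht _)
    have h2 := (hasDerivAt_charP (P₀ := P₀) (E₀ := E₀) x t).congr_of_eventuallyEq
      (f₁ := fun s => charP P₀ E₀ (charInv P₀ E₀ (charX P₀ E₀ x s) s) s) (by
        filter_upwards [Ioo_mem_nhds ht.1 ht.2] with s hs
        rw [hinv s ⟨hs.1.le, hs.2⟩])
    have h3 := h1.unique h2
    simp only [Function.comp_apply] at h3
    simp only [hinv t ⟨ht.1.le, ht.2⟩]
    linarith
  · obtain ⟨x, rfl⟩ := (charX_bijective hP hE (hJ t ⟨ht.1.le, ht.2⟩)).surjective ρ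
    have h1 := hasDerivAt_comp_char_time (P₀ := P₀) (E₀ := E₀) (x := x)
      (differentiableAt_of_contDiffOn_strip hCE ht _)
    have h2 := (hasDerivAt_charE (P₀ := P₀) (E₀ := E₀) x t).congr_of_eventuallyEq
      (f₁ := fun s => charE P₀ E₀ (charInv P₀ E₀ (charX P₀ E₀ x s) s) s) (by
        filter_upwards [Ioo_mem_nhds ht.1 ht.2] with s hs
        rw [hinv s ⟨hs.1.le, hs.2⟩])
    have h3 := h1.unique h2
    simp only [Function.comp_apply] at h3
    simp only [hinv t ⟨ht.1.le, ht.2⟩]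
    linarith
  · simp only [hzero, charP_zero]
  · simp only [hzero, charE_zero]

end Existence

/-! ### Finite lifespan and blow-up of the gradient -/

section BlowUp

variable {P₀ E₀ : ℝ → ℝ}

/-- If the energy of the data is not constant, some neighbouring characteristics meet. -/
theorem exists_charJ_nonpos (hP : ContDiff ℝ 1 P₀) (hE : ContDiff ℝ 1 E₀)
    (hne : ¬ ∃ C : ℝ, ∀ ρ : ℝ, energy (P₀ ρ) (E₀ ρ) = C) :
    ∃ t, 0 ≤ t ∧ ∃ x, charJ P₀ E₀ x t ≤ 0 := by
  obtain ⟨x, hx⟩ : ∃ x, velocity (P₀ x) * deriv P₀ x + E₀ x * deriv E₀ x ≠ 0 := by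
    by_contra! hcon
    refine hne ⟨energy (P₀ 0) (E₀ 0), fun ρ => ?_⟩
    have hd : ∀ x, HasDerivAt (fun x => energy (P₀ x) (E₀ x)) 0 x := fun x => by
      have h := (((hasDerivAt_sqrt_one_add_sq (P₀ x)).comp x
        (hP.differentiable one_ne_zero x).hasDerivAt).const_mul 2).add
        ((hE.differentiable one_ne_zero x).hasDerivAt.pow 2)
      refine h.congr_deriv ?_
      push_cast
      linear_combination 2 * hcon x
    exact is_const_of_deriv_eq_zero (fun t => (hd t).differentiableAt) (fun t => (hd t).deriv) ρ 0
  obtain ⟨t, ht, hb⟩ := exists_linearized_le (hasDerivAt_charP (P₀ := P₀) (E₀ := E₀) x)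
    (hasDerivAt_charE x) (hasDerivAt_charDP x) (hasDerivAt_charDE x)
    (by rwa [charP_zero, charE_zero, charDP_zero, charDE_zero]) (deriv E₀ x - 1)
  exact ⟨t, ht, x, by rw [charJ]; linarith⟩

/-- Bounded initial derivatives make the constant uniform in `x`. This gives `T > 0`, and small
values of `J` somewhere just before `T`. -/
theorem exists_abs_charJ_sub_le (hP : ∃ L, ∀ ρ, |deriv P₀ ρ| ≤ L) (hE : ∃ L, ∀ ρ, |deriv E₀ ρ| ≤ L)
    (τ : ℝ) : ∃ C, 0 < C ∧ ∀ x, ∀ s ∈ Icc 0 τ, ∀ t ∈ Icc 0 τ,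
      |charJ P₀ E₀ x t - charJ P₀ E₀ x s| ≤ C * |t - s| := by
  obtain ⟨L₁, hL₁⟩ := hP
  obtain ⟨L₂, hL₂⟩ := hE
  have h1 : 0 ≤ L₁ := (abs_nonneg _).trans (hL₁ 0)
  have h2 : 0 ≤ L₂ := (abs_nonneg _).trans (hL₂ 0)
  refine ⟨(L₁ + L₂ + 1) * Real.exp τ, by positivity, fun x s hs t ht => ?_⟩
  refine (convex_Icc 0 τ).norm_image_sub_le_of_norm_hasDerivWithin_le (f := charJ P₀ E₀ x)
    (fun r _ => (hasDerivAt_charJ x r).hasDerivWithinAt) (fun r hr => ?_) hs ht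
  refine (abs_velocityDeriv_mul_le _ _).trans ?_
  have h3 := (norm_fst_le _).trans (norm_charD_le (P₀ := P₀) (E₀ := E₀) x 0 r)
  refine h3.trans ?_
  have h4 : ‖(charDP P₀ E₀ x 0, charDE P₀ E₀ x 0)‖ ≤ L₁ + L₂ + 1 := by
    rw [charDP_zero, charDE_zero, Prod.norm_def]
    exact max_le ((hL₁ x).trans (by linarith)) ((hL₂ x).trans (by linarith))
  rw [sub_zero, abs_of_nonneg hr.1]
  gcongr
  exact hr.2

/-- If `|E₀'| ≤ 1/4`, then `J ≤ 1/2` forces `|b| ≥ 1/4`. Otherwise `(a, b)` starts with norm above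
`1/4` and decays at most exponentially. -/
theorem le_abs_charD_add {x t : ℝ} (hJ : charJ P₀ E₀ x t ≤ 1 / 2) :
    Real.exp (-|t|) / 4 ≤ |charDP P₀ E₀ x t| + |charDE P₀ E₀ x t| := by
  have hexp : Real.exp (-|t|) ≤ 1 := Real.exp_le_one_iff.2 (neg_nonpos.2 (abs_nonneg t))
  by_cases hd : |deriv E₀ x| ≤ 1 / 4
  · have h1 : 1 / 4 ≤ |charDE P₀ E₀ x t| := by
      rw [charJ] at hJ
      have h2 := (abs_le.1 hd).2
      have h3 := neg_abs_le (charDE P₀ E₀ x t)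
      linarith
    have := abs_nonneg (charDP P₀ E₀ x t)
    linarith
  · push Not at hd
    have h1 := (norm_snd_le _).trans (norm_charD_le (P₀ := P₀) (E₀ := E₀) x t 0)
    have h2 : ‖(charDP P₀ E₀ x t, charDE P₀ E₀ x t)‖ ≤
        |charDP P₀ E₀ x t| + |charDE P₀ E₀ x t| := by
      rw [Prod.norm_def, Real.norm_eq_abs, Real.norm_eq_abs]
      exact max_le (by linarith [abs_nonneg (charDE P₀ E₀ x t)])
        (by linarith [abs_nonneg (charDP P₀ E₀ x t)])
    simp only [charDE_zero, Real.norm_eq_abs, zero_sub, abs_neg] at h1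
    have h3 : 1 / 4 ≤ (|charDP P₀ E₀ x t| + |charDE P₀ E₀ x t|) * Real.exp |t| :=
      hd.le.trans (h1.trans (by gcongr))
    rw [Real.exp_neg, div_eq_mul_inv, mul_comm, ← div_eq_mul_inv, div_le_iff₀ (Real.exp_pos _)]
    linarith

theorem derivativesBlowUpAt_sInf (hP : IsAdmissibleDatum P₀) (hE : IsAdmissibleDatum E₀)
    (hne : ¬ ∃ C : ℝ, ∀ ρ : ℝ, energy (P₀ ρ) (E₀ ρ) = C) :
    DerivativesBlowUpAt P₀ E₀ (sInf {t | 0 ≤ t ∧ ∃ x, charJ P₀ E₀ x t ≤ 0}) := by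
  set S : Set ℝ := {t | 0 ≤ t ∧ ∃ x, charJ P₀ E₀ x t ≤ 0} with hS
  have hSne : S.Nonempty := exists_charJ_nonpos hP.1 hE.1 hne
  have hSbdd : BddBelow S := ⟨0, fun t ht => ht.1⟩
  set T := sInf S with hT
  have hTpos : 0 < T := by
    obtain ⟨C, hC0, hC⟩ := exists_abs_charJ_sub_le hP.2 hE.2 1
    refine lt_of_lt_of_le (by positivity : 0 < 1 / (C + 1)) (le_csInf hSne ?_)
    rintro t ⟨ht0, x, hx⟩
    by_contra! hlt
    have ht1 : t ≤ 1 := hlt.le.trans (by rw [div_le_one (by positivity)]; linarith)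
    have h1 := (abs_le.1 (hC x 0 ⟨le_rfl, zero_le_one⟩ t ⟨ht0, ht1⟩)).1
    rw [charJ_zero, sub_zero, abs_of_nonneg ht0] at h1
    rw [lt_div_iff₀ (by positivity)] at hlt
    linarith
  have hJ : ∀ t ∈ Ico 0 T, ∀ x, 0 < charJ P₀ E₀ x t := fun t ht x => by
    by_contra! hle
    exact (csInf_le hSbdd ⟨ht.1, x, hle⟩).not_gt ht.2
  have hsol := isC1Solution_of_charJ_pos hP.1 hE.1 hTpos hJ
  refine ⟨hTpos, _, _, hsol, fun T' Q F hQF => ?_, ?_⟩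
  · have hle : T' ≤ T := by
      by_contra! hlt
      obtain ⟨t, ⟨ht0, x, hx⟩, ht⟩ := exists_lt_of_csInf_lt hSne hlt
      exact (hQF.charJ_pos hP.1 hE.1 x ⟨ht0, ht⟩).not_ge hx
    refine ⟨hle, ?_, ?_⟩
    · rintro ⟨ρ, t⟩ ⟨-, ht⟩
      have h := (hQF.eq_char (charInv P₀ E₀ ρ t) ht).1
      rwa [charX_charInv hP.1 hE.1 (hJ t ⟨ht.1, ht.2.trans_le hle⟩)] at h
    · rintro ⟨ρ, t⟩ ⟨-, ht⟩
      have h := (hQF.eq_char (charInv P₀ E₀ ρ t) ht).2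
      rwa [charX_charInv hP.1 hE.1 (hJ t ⟨ht.1, ht.2.trans_le hle⟩)] at h
  · rw [ENNReal.tendsto_nhds_top_iff_nnreal]
    intro M
    obtain ⟨C, hC0, hC⟩ := exists_abs_charJ_sub_le hP.2 hE.2 (T + 1)
    set δ := Real.exp (-T) / 4 with hδ
    have hδ0 : 0 < δ := by positivity
    -- `J ≤ m` both triggers `le_abs_charD_add` and makes `δ / J ≥ M + 1`. Below, `η` is the time
    -- window in which `J` varies by at most `m`, kept below 1 to stay in `[0, T + 1]`.
    set m := min (1 / 2) (δ / (M + 1)) with hm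
    have hm0 : 0 < m := by positivity
    set η := min 1 (m / (2 * C)) with hη
    have hη0 : 0 < η := by positivity
    have hCη : C * (2 * η) ≤ m := by
      have : η ≤ m / (2 * C) := min_le_right _ _
      rw [le_div_iff₀ (by positivity)] at this
      linarith
    filter_upwards [Ioo_mem_nhdsLT (show max 0 (T - η) < T from max_lt hTpos (by linarith))]
      with t ht
    have ht0 : 0 < t := (le_max_left _ _).trans_lt ht.1
    have htη : T - η < t := (le_max_right _ _).trans_lt ht.1
    -- The infimum is not known to be attained, so `x` is taken from a time `s` slightly after `T`
    -- and `J` is compared at `t` and `s`.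
    obtain ⟨s, ⟨hs0, x, hx⟩, hs⟩ := exists_lt_of_csInf_lt hSne (show T < T + η by linarith)
    have hη1 : η ≤ 1 := min_le_left _ _
    have hTs : T ≤ s := csInf_le hSbdd ⟨hs0, x, hx⟩
    have hjpos := hJ t ⟨ht0.le, ht.2⟩ x
    have hjle : charJ P₀ E₀ x t ≤ m := by
      have h1 := (abs_le.1 (hC x s ⟨hs0, by linarith⟩ t ⟨ht0.le, by linarith [ht.2]⟩)).2
      have h2 : |t - s| ≤ 2 * η := abs_le.2 ⟨by linarith, by linarith [ht.2]⟩
      have h3 := mul_le_mul_of_nonneg_left h2 hC0.le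
      linarith
    have hD := le_abs_charD_add (hjle.trans (min_le_left _ _))
    have hδle : δ ≤ |charDP P₀ E₀ x t| + |charDE P₀ E₀ x t| := by
      refine le_trans ?_ hD
      rw [hδ, abs_of_pos ht0]
      have := Real.exp_le_exp.2 (neg_le_neg ht.2.le)
      linarith
    obtain ⟨e1, e2⟩ := hsol.deriv_mul_charJ hP.1 hE.1 x ⟨ht0, ht.2⟩
    rw [← e1, ← e2, abs_mul, abs_mul, ← add_mul, abs_of_pos hjpos] at hδle
    refine lt_of_lt_of_le ?_ (le_iSup _ (charX P₀ E₀ x t))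
    rw [← ENNReal.ofReal_coe_nnreal]
    refine (ENNReal.ofReal_lt_ofReal_iff_of_nonneg M.coe_nonneg).2 ?_
    have hjM : charJ P₀ E₀ x t * (M + 1) ≤ δ := by
      have := hjle.trans (min_le_right _ _)
      rwa [le_div_iff₀ (by positivity)] at this
    have hM : (M : ℝ) + 1 ≤ _ := le_of_mul_le_mul_right
      ((mul_comm _ _).trans_le (hjM.trans hδle)) hjpos
    linarith

end BlowUp

end ColdPlasma

theorem mainTheorem5 :
    ∃ ε : ℝ, 0 < ε ∧ ∀ P₀ E₀ : ℝ → ℝ,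
      ColdPlasma.IsAdmissibleDatum P₀ → ColdPlasma.IsAdmissibleDatum E₀ →
      (∀ ρ : ℝ, |P₀ ρ| ≤ ε ∧ |E₀ ρ| ≤ ε) →
      (¬ ∃ C : ℝ, ∀ ρ : ℝ, ColdPlasma.energy (P₀ ρ) (E₀ ρ) = C) →
      ∃ T : ℝ, ColdPlasma.DerivativesBlowUpAt P₀ E₀ T :=
  -- The smallness of the data is not needed.
  ⟨1, one_pos, fun _ _ hP hE _ hne => ⟨_, ColdPlasma.derivativesBlowUpAt_sInf hP hE hne⟩⟩
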